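/- **Setting (Feedback MAB).** There are $n$ arms. The hidden state of arm $i$ is good or bad and evolves, independently of the other arms and of the plays, as a two-state Markov chain with $\Pr[\text{bad}\to\text{good}]=\alpha_i>0$, $\Pr[\text{good}\to\text{bad}]=\beta_i>0$ and $\alpha_i+\beta_i\le 1-\delta$ for some $\delta>0$. In each step a policy (possibly randomized and history-dependent) plays at most one arm; playing arm $i$ reveals its current state and yields reward $r_i\ge 0$ if that state is good and $0$ otherwise; arms that are not played are not observed. Thus the player's information on arm $i$ is a pair $(s,t)$: the arm was last observed $t\ge1$ steps ago, in state $s\in\{g,b\}$. The initial information $(s_i,t_i)$ on every arm is given and arbitrary. **Single-arm problem.** For a penalty $\lambda$ per play, let $H_i(\lambda)$ be the optimal long-run average of reward minus penalty when only arm $i$ is present and it may be played or not in each step (this does not depend on the initial information). Let $\omega$ denote the probability that the arm is good at present. Playing is an optimal decision at belief $\omega_0$ if there is a continuous relative value function $V:[0,1]\to\mathbb R$ that solves the average-reward optimality equation $$H_i(\lambda)+V(\omega)=\max\bigl\{\omega\,(r_i+V(1-\beta_i))+(1-\omega)V(\alpha_i)-\lambda,\;\; V(\omega(1-\beta_i)+(1-\omega)\alpha_i)\bigr\}\qquad(0\le\omega\le1)$$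 and for which the first term (play) is at least the second (do not play) at $\omega=\omega_0$. The Whittle index $\Pi_i(s,t)$ is the supremum of the penalties $\lambda$ for which playing is an optimal decision at the belief that corresponds to $(s,t)$. **Policy.** Threshold-Whittle$(\lambda)$ acts as follows in each step: if some arm $i$ is in state $(g,1)$ and $r_i(1-\beta_i)\ge\lambda$, it plays such an arm; otherwise it plays an arm whose current state has the highest Whittle index. Ties are broken arbitrarily. **Theorem.** There is exactly one real number $\lambda^*$ with $\lambda^*=\sum_{i=1}^n H_i(\lambda^*)$, and Threshold-Whittle$(\lambda^*)$ is a $2$-approximation for Feedback MAB: if $R_T(\pi)$ denotes the expected total reward of a policy $\pi$ in the first $T$ steps, then for every Threshold-Whittle$(\lambda^*)$ policy $\pi$ and every policy $\sigma$, $$\limsup_{T\to\infty}\frac{R_T(\sigma)}{T}\;\le\;2\,\liminf_{T\to\infty}\frac{R_T(\pi)}{T}.$$ -/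

import Mathlib

open Filter

noncomputable section

namespace FeedbackMAB

/-- The data of one arm: a two-state Markov chain with `Pr[bad → good] = α`,
`Pr[good → bad] = β`, and the reward `r` of a play in the good state.  The chain is ergodic
(`α, β > 0`) and bursty (`α + β ≤ 1 - δ` for some `δ > 0`). -/
structure Arm where
  α : ℝ
  β : ℝ
  r : ℝ
  α_pos : 0 < α
  β_pos : 0 < β
  bursty : α + β < 1
  r_nonneg : 0 ≤ r

/-- The information `(s, t)` on an arm: it was last observed `t ≥ 1` steps ago, in state `s`
(`true` is the good state `g`, `false` is the bad state `b`). -/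
abbrev InfoState : Type := Bool × ℕ+

/-- One-step transition probabilities of the hidden state of an arm. -/
def Arm.trans (a : Arm) : Bool → Bool → ℝ
  | true, true => 1 - a.β
  | true, false => a.β
  | false, true => a.α
  | false, false => 1 - a.α

/-- If an arm is good with probability `ω` now, it is good with this probability one step later. -/
def Arm.evolve (a : Arm) (ω : ℝ) : ℝ := ω * (1 - a.β) + (1 - ω) * a.α

/-- Probability that the arm is good `t` steps after it was in state `s`. -/
def Arm.goodProb (a : Arm) (s : Bool) : ℕ → ℝ
  | 0 => if s then 1 else 0
  | t + 1 => a.evolve (a.goodProb s t)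

/-- Probability that the arm is good now, given the information `(s, t)`
(this is `u_t` for `s = g` and `v_t` for `s = b`). -/
def Arm.belief (a : Arm) (x : InfoState) : ℝ := a.goodProb x.1 x.2

section Bandit

variable {ι : Type} [Fintype ι] [DecidableEq ι]

/-- What the player has seen, most recent step first: `none` for a step without a play,
`some (i, s)` for a step in which arm `i` was played and found in state `s`. -/
abbrev History (ι : Type) : Type := List (Option (ι × Bool))

/-- A (randomized, history-dependent) policy: the law of the next action, given the history.
The action `some i` plays arm `i`, and `none` plays no arm. -/
abbrev Policy (ι : Type) : Type := History ι → PMF (Option ι)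

/-- What is seen when the hidden states are `s` and the action `c` is taken. -/
def observe (s : ι → Bool) (c : Option ι) : Option (ι × Bool) := c.map fun i => (i, s i)

/-- Immediate reward, minus a penalty `lam` per play. -/
def payoff (arms : ι → Arm) (lam : ℝ) (s : ι → Bool) : Option ι → ℝ
  | none => 0
  | some i => (if s i then (arms i).r else 0) - lam

/-- Expected total reward minus penalty in the next `T` steps under the policy `π`, given the
history and the current hidden states.  The arms evolve independently of each other and of the
plays. -/
def totalFrom (arms : ι → Arm) (lam : ℝ) (π : Policy ι) : ℕ → History ι → (ι → Bool) → ℝ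
  | 0, _, _ => 0
  | T + 1, h, s => ∑ c : Option ι, (π h c).toReal *
      (payoff arms lam s c +
        ∑ s' : ι → Bool, (∏ i, (arms i).trans (s i) (s' i)) *
          totalFrom arms lam π T (observe s c :: h) s')

/-- Expected total reward minus penalty in the first `T` steps under the policy `π`, when the
initial information on arm `i` is `x i`. -/
def total (arms : ι → Arm) (lam : ℝ) (x : ι → InfoState) (π : Policy ι) (T : ℕ) : ℝ :=
  ∑ s : ι → Bool,
    (∏ i, if s i then (arms i).belief (x i) else 1 - (arms i).belief (x i)) *
      totalFrom arms lam π T [] s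

/-- Expected reward per step in the first `T` steps (no penalty). -/
def averageReward (arms : ι → Arm) (x : ι → InfoState) (π : Policy ι) (T : ℕ) : ℝ :=
  total arms 0 x π T / T

/-- The information on all arms after the history, starting from `x`. -/
def infoAfter (x : ι → InfoState) : History ι → ι → InfoState
  | [] => x
  | none :: h => fun i => ((infoAfter x h i).1, (infoAfter x h i).2 + 1)
  | some (j, s) :: h => fun i =>
      if i = j then (s, 1) else ((infoAfter x h i).1, (infoAfter x h i).2 + 1)

end Bandit

/-- `H(lam)`: the optimal long-run average of reward minus penalty in the single-arm problem, in
which the arm may or may not be played in each step and each play costs `lam`.  (The chain being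
ergodic, the optimum does not depend on the initial information.) -/
def Arm.H (a : Arm) (lam : ℝ) : ℝ :=
  sSup {c : ℝ | ∃ (x : InfoState) (π : Policy Unit),
    c = liminf (fun T : ℕ => total (fun _ : Unit => a) lam (fun _ => x) π T / (T : ℝ)) atTop}

/-- One-step lookahead value of playing the arm when it is good with probability `ω`, if `V` is
the relative value of the next belief: the play reveals the state. -/
def Arm.playValue (a : Arm) (lam : ℝ) (V : ℝ → ℝ) (ω : ℝ) : ℝ :=
  ω * (a.r + V (1 - a.β)) + (1 - ω) * V a.α - lam

/-- One-step lookahead value of not playing the arm. -/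
def Arm.restValue (a : Arm) (V : ℝ → ℝ) (ω : ℝ) : ℝ := V (a.evolve ω)

/-- `V` is a relative value function of the single-arm problem with penalty `lam`: a continuous
function of the belief that solves the average-reward optimality (Bellman) equation. -/
def Arm.IsRelativeValue (a : Arm) (lam : ℝ) (V : ℝ → ℝ) : Prop :=
  ContinuousOn V (Set.Icc 0 1) ∧
    ∀ ω ∈ Set.Icc (0 : ℝ) 1, a.H lam + V ω = max (a.playValue lam V ω) (a.restValue V ω)

/-- Playing is an optimal decision in the information state `x` of the single-arm problem with
penalty `lam`. -/
def Arm.PlayOptimal (a : Arm) (lam : ℝ) (x : InfoState) : Prop :=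
  ∃ V : ℝ → ℝ, a.IsRelativeValue lam V ∧
    a.restValue V (a.belief x) ≤ a.playValue lam V (a.belief x)

/-- The Whittle index of the information state `x`: the largest penalty per play at which the
optimal decision in `x` switches from not playing to playing as the penalty decreases. -/
def Arm.whittleIndex (a : Arm) (x : InfoState) : ℝ := sSup {lam : ℝ | a.PlayOptimal lam x}

section ThresholdWhittle

variable {ι : Type}

/-- Arm `i` is in state `(g, 1)` and its myopic reward is at least the threshold. -/
def TopPriority (arms : ι → Arm) (lam : ℝ) (x : ι → InfoState) (i : ι) : Prop :=
  x i = (true, 1) ∧ lam ≤ (arms i).r * (1 - (arms i).β)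

/-- Arm `i` is a choice of the Threshold-Whittle rule in the joint information state `x`: an arm of
top priority if there is one, and otherwise an arm of highest Whittle index. -/
def ThresholdWhittleChoice (arms : ι → Arm) (lam : ℝ) (x : ι → InfoState) (i : ι) : Prop :=
  TopPriority arms lam x i ∨
    ((∀ j, ¬ TopPriority arms lam x j) ∧
      ∀ j, (arms j).whittleIndex (x j) ≤ (arms i).whittleIndex (x i))

/-- `π` is a Threshold-Whittle policy (ties may be broken in any way). -/
def IsThresholdWhittle [DecidableEq ι] (arms : ι → Arm) (lam : ℝ) (x : ι → InfoState)
    (π : Policy ι) : Prop :=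
  ∀ h : History ι, ∀ c ∈ (π h).support,
    ∃ i, c = some i ∧ ThresholdWhittleChoice arms lam (infoAfter x h) i

end ThresholdWhittle

end FeedbackMAB

end

/-!
Relaxing the constraint of one play per step with the multiplier `λ*` decouples the arms: every
policy earns at most `λ* + ∑ i, H i λ* = 2 λ*` per step, so it suffices that Threshold-Whittle earns
`λ*` per step.

Value the information on each arm by the policy that is optimal for the arm alone at penalty `λ*`.
A play of an arm in state `(g, 1)` with a myopic reward of at least `λ*`, or of an arm whose index
is at least `λ*`, then gains at least `λ*` in reward plus value, while the other arms lose nothing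
by resting.  Otherwise all indices are smaller than `λ*`: resting is optimal for every arm on its
own and gains `H i λ*`, and the play gains at least as much; the total is `∑ i, H i λ* = λ*` again.

For a single arm the optimal policies wait a fixed time after a bad observation, which yields `H`,
the relative values and the index explicitly.
-/

namespace FeedbackMAB

open Set Topology

section LinearGrowth

theorem tendsto_mul_add_div_nat (c C : ℝ) :
    Tendsto (fun T : ℕ => (c * T + C) / (T : ℝ)) atTop (𝓝 c) := by
  have h : Tendsto (fun T : ℕ => c + C / (T : ℝ)) atTop (𝓝 (c + 0)) :=
    tendsto_const_nhds.add (tendsto_const_div_atTop_nhds_zero_nat C)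
  rw [add_zero] at h
  refine h.congr' ?_
  filter_upwards [eventually_ne_atTop 0] with T hT
  field_simp

variable {u : ℕ → ℝ} {c C d D : ℝ}

theorem isBoundedUnder_le_div_nat (hu : ∀ T : ℕ, u T ≤ c * T + C) :
    IsBoundedUnder (· ≤ ·) atTop fun T : ℕ => u T / (T : ℝ) :=
  (tendsto_mul_add_div_nat c C).isBoundedUnder_le.mono_le
    (.of_forall fun T => div_le_div_of_nonneg_right (hu T) T.cast_nonneg)

theorem isBoundedUnder_ge_div_nat (hl : ∀ T : ℕ, d * T + D ≤ u T) :
    IsBoundedUnder (· ≥ ·) atTop fun T : ℕ => u T / (T : ℝ) :=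
  (tendsto_mul_add_div_nat d D).isBoundedUnder_ge.mono_ge
    (.of_forall fun T => div_le_div_of_nonneg_right (hl T) T.cast_nonneg)

theorem limsup_div_nat_le (hl : ∀ T : ℕ, d * T + D ≤ u T) (hu : ∀ T : ℕ, u T ≤ c * T + C) :
    limsup (fun T : ℕ => u T / (T : ℝ)) atTop ≤ c := by
  rw [← (tendsto_mul_add_div_nat c C).limsup_eq]
  exact limsup_le_limsup
    (.of_forall fun T => div_le_div_of_nonneg_right (hu T) T.cast_nonneg)
    (isBoundedUnder_ge_div_nat hl).isCoboundedUnder_le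
    (tendsto_mul_add_div_nat c C).isBoundedUnder_le

theorem le_liminf_div_nat (hl : ∀ T : ℕ, d * T + D ≤ u T) (hu : ∀ T : ℕ, u T ≤ c * T + C) :
    d ≤ liminf (fun T : ℕ => u T / (T : ℝ)) atTop := by
  rw [← (tendsto_mul_add_div_nat d D).liminf_eq]
  exact liminf_le_liminf
    (.of_forall fun T => div_le_div_of_nonneg_right (hl T) T.cast_nonneg)
    (tendsto_mul_add_div_nat d D).isBoundedUnder_ge
    (isBoundedUnder_le_div_nat hu).isCoboundedUnder_ge

theorem liminf_div_nat_le (hl : ∀ T : ℕ, d * T + D ≤ u T) (hu : ∀ T : ℕ, u T ≤ c * T + C) :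
    liminf (fun T : ℕ => u T / (T : ℝ)) atTop ≤ c :=
  (liminf_le_limsup (isBoundedUnder_le_div_nat hu) (isBoundedUnder_ge_div_nat hl)).trans
    (limsup_div_nat_le hl hu)

end LinearGrowth

theorem existsUnique_eq_of_antitoneOn {f : ℝ → ℝ} (hcont : ContinuousOn f (Ici 0))
    (hanti : AntitoneOn f (Ici 0)) (hnonneg : ∀ l, 0 ≤ f l) : ∃! l, l = f l := by
  obtain ⟨l, -, hl⟩ : ∃ l ∈ Icc 0 (f 0), l - f l = 0 := by
    refine intermediate_value_Icc (hnonneg 0)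
      (continuousOn_id.sub (hcont.mono Icc_subset_Ici_self)) ⟨by simpa using hnonneg 0, ?_⟩
    simpa using hanti self_mem_Ici (hnonneg 0) (hnonneg 0)
  have fixed_le : ∀ {l m}, l = f l → m = f m → m ≤ l := fun {l m} hl hm => by
    by_contra! hlt
    have := hanti (mem_Ici.2 (hl ▸ hnonneg l)) (mem_Ici.2 (hm ▸ hnonneg m)) hlt.le
    linarith
  have hl' : l = f l := sub_eq_zero.1 hl
  exact ⟨l, hl', fun m hm => (fixed_le hl' hm).antisymm (fixed_le hm hl')⟩

section FiniteLaws

theorem sum_toReal_mul_le {κ : Type*} [Fintype κ] (p : PMF κ) {f : κ → ℝ} {b : ℝ}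
    (hf : ∀ c ∈ p.support, f c ≤ b) : ∑ c, (p c).toReal * f c ≤ b := by
  have total_mass : ∑ c, (p c).toReal = 1 := by
    rw [← ENNReal.toReal_sum fun c _ => p.apply_ne_top c, ← tsum_fintype (L := .unconditional _),
      p.tsum_coe, ENNReal.toReal_one]
  calc ∑ c, (p c).toReal * f c ≤ ∑ c, (p c).toReal * b := by
        refine Finset.sum_le_sum fun c _ => ?_
        by_cases hc : c ∈ p.support
        · exact mul_le_mul_of_nonneg_left (hf c hc) ENNReal.toReal_nonneg
        · simp [(p.apply_eq_zero_iff c).2 hc]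
    _ = b := by rw [← Finset.sum_mul, total_mass, one_mul]

theorem le_sum_toReal_mul {κ : Type*} [Fintype κ] (p : PMF κ) {f : κ → ℝ} {b : ℝ}
    (hf : ∀ c ∈ p.support, b ≤ f c) : b ≤ ∑ c, (p c).toReal * f c := by
  have := sum_toReal_mul_le p fun c hc => neg_le_neg (hf c hc)
  simp only [mul_neg, Finset.sum_neg_distrib] at this
  exact neg_le_neg_iff.1 this

variable {ι κ R : Type*} [Fintype ι] [DecidableEq ι] [Fintype κ] [CommSemiring R]

/-- Expectation of `F` when the coordinates `s i` are independent with laws `p i`.  The weights are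
not required to be nonnegative or to have total mass one. -/
noncomputable def productExpect (p : ι → κ → R) (F : (ι → κ) → R) : R :=
  ∑ s, (∏ i, p i (s i)) * F s

theorem productExpect_const {p : ι → κ → R} (hp : ∀ i, ∑ b, p i b = 1) (c : R) :
    productExpect p (fun _ => c) = c := by
  rw [productExpect, ← Finset.sum_mul, ← Fintype.prod_sum]
  simp [hp]

theorem productExpect_add (p : ι → κ → R) (F G : (ι → κ) → R) :
    productExpect p (fun s => F s + G s) = productExpect p F + productExpect p G := by
  simp only [productExpect, mul_add, Finset.sum_add_distrib]

theorem productExpect_productExpect (p : ι → κ → R) (q : ι → κ → κ → R) (F : (ι → κ) → R) :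
    productExpect p (fun s => productExpect (fun i => q i (s i)) F) =
      productExpect (fun i c => ∑ b, p i b * q i b c) F := by
  simp only [productExpect, Finset.mul_sum]
  rw [Finset.sum_comm]
  refine Finset.sum_congr rfl fun s' _ => ?_
  simp only [← mul_assoc, ← Finset.sum_mul, ← Finset.prod_mul_distrib, Fintype.prod_sum]

theorem productExpect_eq_sum_conditioned [DecidableEq κ] (p : ι → κ → R) (j : ι)
    (F : κ → (ι → κ) → R) :
    productExpect p (fun s => F (s j) s) =
      ∑ b, p j b * productExpect (Function.update p j (Pi.single b 1)) (F b) := by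
  have weight (b : κ) (s : ι → κ) : ∏ i, Function.update p j (Pi.single b 1) i (s i) =
      (if s j = b then 1 else 0) * ∏ i ∈ Finset.univ.erase j, p i (s i) := by
    rw [← Finset.mul_prod_erase _ _ (Finset.mem_univ j)]
    congr 1
    · simp [Pi.single_apply]
    · refine Finset.prod_congr rfl fun i hi => ?_
      rw [Function.update_of_ne (Finset.ne_of_mem_erase hi)]
  simp only [productExpect, weight, Finset.mul_sum]
  rw [Finset.sum_comm]
  refine Finset.sum_congr rfl fun s _ => ?_
  rw [Finset.sum_eq_single (s j) (fun b _ hb => by simp [hb.symm]) (by simp),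
    ← Finset.mul_prod_erase _ _ (Finset.mem_univ j)]
  simp [mul_assoc]

theorem productExpect_coord {p : ι → κ → R} (hp : ∀ i, ∑ b, p i b = 1) (j : ι) (f : κ → R) :
    productExpect p (fun s => f (s j)) = ∑ b, p j b * f b := by
  classical
  rw [productExpect_eq_sum_conditioned p j fun b _ => f b]
  refine Finset.sum_congr rfl fun b _ => ?_
  rw [productExpect_const fun i => ?_]
  rcases eq_or_ne i j with rfl | hij
  · simp
  · simp [Function.update_of_ne hij, hp]

end FiniteLaws

/-- The information on an arm after one more step in which it is not played. -/
abbrev InfoState.aged (x : InfoState) : InfoState := (x.1, x.2 + 1)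

namespace Arm

variable (a : Arm)

/-- Law of the state of the arm given the information `x`. -/
noncomputable def stateProb (x : InfoState) (s : Bool) : ℝ :=
  if s then a.belief x else 1 - a.belief x

/-- Expected reward of a play plus expected value of the resulting information, if `V` is the value
of the information held in the next step. -/
noncomputable def infoPlayValue (V : InfoState → ℝ) (x : InfoState) : ℝ :=
  a.belief x * (a.r + V (true, 1)) + (1 - a.belief x) * V (false, 1)

theorem evolve_mem_Icc {ω : ℝ} (hω : ω ∈ Icc (0 : ℝ) 1) : a.evolve ω ∈ Icc a.α (1 - a.β) := by
  have := mul_nonneg hω.1 (sub_nonneg.2 a.bursty.le)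
  have := mul_nonneg (sub_nonneg.2 hω.2) (sub_nonneg.2 a.bursty.le)
  simp only [evolve]
  constructor <;> linarith

theorem Icc_alpha_subset : Icc a.α (1 - a.β) ⊆ Icc 0 1 :=
  Icc_subset_Icc a.α_pos.le (by linarith [a.β_pos])

theorem goodProb_mem_Icc (s : Bool) : ∀ t, a.goodProb s t ∈ Icc (0 : ℝ) 1
  | 0 => by cases s <;> simp [goodProb]
  | t + 1 => a.Icc_alpha_subset (a.evolve_mem_Icc (goodProb_mem_Icc s t))

theorem belief_aged (x : InfoState) : a.belief x.aged = a.evolve (a.belief x) := rfl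

theorem belief_good_one : a.belief (true, 1) = 1 - a.β := by
  simp [belief, goodProb, evolve]

theorem belief_bad_one : a.belief (false, 1) = a.α := by
  simp [belief, goodProb, evolve]

theorem belief_mem_Icc (x : InfoState) : a.belief x ∈ Icc a.α (1 - a.β) := by
  obtain ⟨s, t⟩ := x
  rw [belief, ← PNat.natPred_add_one t]
  exact a.evolve_mem_Icc (a.goodProb_mem_Icc s t.natPred)

theorem belief_nonneg (x : InfoState) : 0 ≤ a.belief x :=
  a.α_pos.le.trans (a.belief_mem_Icc x).1

theorem belief_le_one (x : InfoState) : a.belief x ≤ 1 :=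
  (a.Icc_alpha_subset (a.belief_mem_Icc x)).2

theorem sum_stateProb (x : InfoState) : ∑ s, a.stateProb x s = 1 := by
  simp [stateProb]

theorem sum_stateProb_mul_trans (x : InfoState) (s' : Bool) :
    ∑ s, a.stateProb x s * a.trans s s' = a.stateProb x.aged s' := by
  cases s' <;> simp only [Fintype.sum_bool, stateProb, trans, belief_aged, evolve, if_true,
    Bool.false_eq_true, if_false]
  ring

theorem trans_eq_stateProb (s s' : Bool) : a.trans s s' = a.stateProb (s, 1) s' := by
  cases s <;> cases s' <;> simp [stateProb, trans, belief_good_one, belief_bad_one]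

end Arm

section Bandit

variable {ι : Type} [DecidableEq ι] (arms : ι → Arm) (lam : ℝ) (x : ι → InfoState)

/-- Law of the state of each arm given the history. -/
noncomputable def stateLaw (h : History ι) (i : ι) : Bool → ℝ :=
  (arms i).stateProb (infoAfter x h i)

theorem sum_stateLaw (h : History ι) (i : ι) : ∑ b, stateLaw arms x h i b = 1 :=
  (arms i).sum_stateProb _

/-- Expected payoff of an action plus expected value `F` of the extended history, given the
history `h`. -/
noncomputable def lookahead (F : History ι → ℝ) (h : History ι) : Option ι → ℝ
  | none => F (none :: h)
  | some i => (arms i).belief (infoAfter x h i) * ((arms i).r + F (some (i, true) :: h)) +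
      (1 - (arms i).belief (infoAfter x h i)) * F (some (i, false) :: h) - lam

theorem lookahead_mono {F G : History ι → ℝ} (hFG : ∀ h, F h ≤ G h) (h : History ι)
    (c : Option ι) : lookahead arms lam x F h c ≤ lookahead arms lam x G h c := by
  cases c with
  | none => exact hFG _
  | some i =>
    have h0 := (arms i).belief_nonneg (infoAfter x h i)
    have h1 := sub_nonneg.2 ((arms i).belief_le_one (infoAfter x h i))
    simp only [lookahead]
    gcongr <;> exact hFG _

theorem lookahead_add_const (F : History ι → ℝ) (k : ℝ) (h : History ι) (c : Option ι) :
    lookahead arms lam x (fun h => F h + k) h c = lookahead arms lam x F h c + k := by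
  cases c with
  | none => rfl
  | some i => simp only [lookahead]; ring

theorem sub_abs_le_lookahead {F : History ι → ℝ} {m : ℝ} (hF : ∀ h, m ≤ F h) (h : History ι)
    (c : Option ι) : m - |lam| ≤ lookahead arms lam x F h c := by
  refine le_trans ?_ (lookahead_mono arms lam x hF h c)
  cases c with
  | none => exact sub_le_self _ (abs_nonneg lam)
  | some i =>
    have := mul_nonneg ((arms i).belief_nonneg (infoAfter x h i)) (arms i).r_nonneg
    simp only [lookahead]
    linarith [le_abs_self lam]

variable [Fintype ι]

theorem productExpect_stateLaw_trans (h : History ι) (F : (ι → Bool) → ℝ) :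
    productExpect (stateLaw arms x h) (fun s => productExpect (fun i => (arms i).trans (s i)) F) =
      productExpect (stateLaw arms x (none :: h)) F := by
  rw [productExpect_productExpect]
  simp only [stateLaw, Arm.sum_stateProb_mul_trans]
  rfl

theorem productExpect_stateLaw_observe (h : History ι) (j : ι) (F : Bool → (ι → Bool) → ℝ) :
    productExpect (stateLaw arms x h)
        (fun s => productExpect (fun i => (arms i).trans (s i)) (F (s j))) =
      ∑ b, stateLaw arms x h j b * productExpect (stateLaw arms x (some (j, b) :: h)) (F b) := by
  rw [productExpect_eq_sum_conditioned (stateLaw arms x h) j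
    fun b s => productExpect (fun i => (arms i).trans (s i)) (F b)]
  refine Finset.sum_congr rfl fun b _ => ?_
  rw [productExpect_productExpect]
  congr 2
  funext i c
  rcases eq_or_ne i j with rfl | hij
  · simp [stateLaw, infoAfter, Pi.single_apply, Arm.trans_eq_stateProb]
  · simp only [stateLaw, infoAfter, Function.update_of_ne hij, if_neg hij,
      Arm.sum_stateProb_mul_trans]

/-- Expected reward minus penalty in the next `T` steps, given the history only. -/
noncomputable def totalAfter (π : Policy ι) (T : ℕ) (h : History ι) : ℝ :=
  productExpect (stateLaw arms x h) (totalFrom arms lam π T h)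

theorem total_eq_totalAfter (π : Policy ι) (T : ℕ) :
    total arms lam x π T = totalAfter arms lam x π T [] := rfl

theorem totalAfter_zero (π : Policy ι) (h : History ι) : totalAfter arms lam x π 0 h = 0 :=
  productExpect_const (sum_stateLaw arms x h) 0

theorem productExpect_step_eq_lookahead (π : Policy ι) (T : ℕ) (h : History ι) (c : Option ι) :
    productExpect (stateLaw arms x h) (fun s => payoff arms lam s c +
        productExpect (fun i => (arms i).trans (s i)) (totalFrom arms lam π T (observe s c :: h))) =
      lookahead arms lam x (totalAfter arms lam x π T) h c := by
  rw [productExpect_add]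
  cases c with
  | none =>
    simp only [payoff, observe, Option.map_none, lookahead, totalAfter]
    rw [productExpect_const (sum_stateLaw arms x h), productExpect_stateLaw_trans, zero_add]
  | some j =>
    simp only [payoff, observe, Option.map_some, lookahead, totalAfter]
    rw [productExpect_coord (sum_stateLaw arms x h) j fun b => (if b then (arms j).r else 0) - lam,
      productExpect_stateLaw_observe arms x h j
        fun b => totalFrom arms lam π T (some (j, b) :: h)]
    simp only [Fintype.sum_bool, stateLaw, Arm.stateProb, if_true, Bool.false_eq_true, if_false]
    ring

theorem totalAfter_succ (π : Policy ι) (T : ℕ) (h : History ι) :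
    totalAfter arms lam x π (T + 1) h =
      ∑ c, (π h c).toReal * lookahead arms lam x (totalAfter arms lam x π T) h c := by
  simp only [← productExpect_step_eq_lookahead, totalAfter, totalFrom, productExpect,
    Finset.mul_sum]
  rw [Finset.sum_comm]
  refine Finset.sum_congr rfl fun c _ => Finset.sum_congr rfl fun s _ => ?_
  ring

variable {arms lam x} {π : Policy ι} {Φ : History ι → ℝ} {c : ℝ}

theorem totalAfter_le_of_lookahead_le {m : ℝ} (hm : ∀ h, m ≤ Φ h)
    (hΦ : ∀ h, ∀ a ∈ (π h).support, lookahead arms lam x Φ h a ≤ c + Φ h) (T : ℕ)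
    (h : History ι) : totalAfter arms lam x π T h ≤ Φ h + (c * T - m) := by
  induction T generalizing h with
  | zero => simpa [totalAfter_zero] using hm h
  | succ T ih =>
    rw [totalAfter_succ]
    refine sum_toReal_mul_le _ fun a ha => (lookahead_mono arms lam x ih h a).trans ?_
    rw [lookahead_add_const, Nat.cast_succ]
    linarith [hΦ h a ha]

theorem le_totalAfter_of_le_lookahead {M : ℝ} (hM : ∀ h, Φ h ≤ M)
    (hΦ : ∀ h, ∀ a ∈ (π h).support, c + Φ h ≤ lookahead arms lam x Φ h a) (T : ℕ)
    (h : History ι) : Φ h + (c * T - M) ≤ totalAfter arms lam x π T h := by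
  induction T generalizing h with
  | zero => simpa [totalAfter_zero] using hM h
  | succ T ih =>
    rw [totalAfter_succ]
    refine le_sum_toReal_mul _ fun a ha => le_trans ?_ (lookahead_mono arms lam x ih h a)
    rw [lookahead_add_const, Nat.cast_succ]
    linarith [hΦ h a ha]

variable (arms lam x π)

theorem neg_abs_mul_le_total (T : ℕ) : -|lam| * T ≤ total arms lam x π T := by
  have drift : ∀ h, ∀ c ∈ (π h).support, -|lam| + 0 ≤ lookahead arms lam x (fun _ => 0) h c :=
    fun h c _ => (add_comm _ _).trans_le (sub_abs_le_lookahead arms lam x (fun _ => le_rfl) h c)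
  simpa [total_eq_totalAfter] using le_totalAfter_of_le_lookahead (fun _ => le_rfl) drift T []

variable {π} (φ : ι → InfoState → ℝ) (h : History ι)

theorem lookahead_sum_none :
    lookahead arms lam x (fun h => ∑ i, φ i (infoAfter x h i)) h none =
      ∑ i, φ i (infoAfter x h i).aged := rfl

theorem lookahead_sum_some (j : ι) :
    lookahead arms lam x (fun h => ∑ i, φ i (infoAfter x h i)) h (some j) =
      ((arms j).infoPlayValue (φ j) (infoAfter x h j) - lam) +
        ∑ i ∈ Finset.univ.erase j, φ i (infoAfter x h i).aged := by
  have split (b : Bool) : ∑ i, φ i (infoAfter x (some (j, b) :: h) i) =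
      φ j (b, 1) + ∑ i ∈ Finset.univ.erase j, φ i (infoAfter x h i).aged := by
    rw [← Finset.add_sum_erase _ _ (Finset.mem_univ j)]
    simp only [infoAfter, if_true]
    congr 1
    exact Finset.sum_congr rfl fun i hi => by rw [if_neg (Finset.ne_of_mem_erase hi)]
  simp only [lookahead, split, Arm.infoPlayValue]
  ring

end Bandit

namespace Arm

section Chain

variable (a : Arm)

/-- The second eigenvalue of the chain: the rate at which the influence of an observation
decays. -/
noncomputable def decay : ℝ := 1 - a.α - a.β

theorem decay_pos : 0 < a.decay := by
  have := a.bursty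
  unfold decay
  linarith

theorem decay_lt_one : a.decay < 1 := by
  have := a.α_pos
  have := a.β_pos
  unfold decay
  linarith

theorem decay_pow_le_decay_pow {s t : ℕ} (hst : s ≤ t) : a.decay ^ t ≤ a.decay ^ s :=
  pow_le_pow_of_le_one a.decay_pos.le a.decay_lt_one.le hst

theorem evolve_sub (ω ω' : ℝ) : a.evolve ω - a.evolve ω' = a.decay * (ω - ω') := by
  simp only [evolve, decay]
  ring

theorem evolve_iterate_sub (k : ℕ) (ω ω' : ℝ) :
    a.evolve^[k] ω - a.evolve^[k] ω' = a.decay ^ k * (ω - ω') := by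
  induction k generalizing ω ω' with
  | zero => simp
  | succ k ih =>
    rw [Function.iterate_succ_apply, Function.iterate_succ_apply, ih, evolve_sub]
    ring

theorem evolve_iterate_mem_Icc {ω : ℝ} (hω : ω ∈ Icc (0 : ℝ) 1) :
    ∀ k, a.evolve^[k] ω ∈ Icc (0 : ℝ) 1
  | 0 => hω
  | k + 1 => by
    rw [Function.iterate_succ_apply']
    exact a.Icc_alpha_subset (a.evolve_mem_Icc (evolve_iterate_mem_Icc hω k))

theorem evolve_iterate_goodProb (s : Bool) (t k : ℕ) :
    a.evolve^[k] (a.goodProb s t) = a.goodProb s (t + k) := by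
  induction k with
  | zero => rfl
  | succ k ih => rw [Function.iterate_succ_apply', ih, ← add_assoc, goodProb]

theorem goodProb_succ_sub (s : Bool) (t : ℕ) :
    a.goodProb s (t + 1) - a.goodProb s t = a.decay ^ t * (a.goodProb s 1 - a.goodProb s 0) := by
  rw [← a.evolve_iterate_sub, evolve_iterate_goodProb, evolve_iterate_goodProb, zero_add,
    add_comm 1]

theorem goodProb_false_succ (t : ℕ) :
    a.goodProb false (t + 1) = a.goodProb false t + a.α * a.decay ^ t := by
  have : a.goodProb false 1 - a.goodProb false 0 = a.α := by simp [goodProb, evolve]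
  linear_combination a.goodProb_succ_sub false t + a.decay ^ t * this

theorem goodProb_true_succ (t : ℕ) :
    a.goodProb true (t + 1) = a.goodProb true t - a.β * a.decay ^ t := by
  have : a.goodProb true 1 - a.goodProb true 0 = -a.β := by simp [goodProb, evolve]
  linear_combination a.goodProb_succ_sub true t + a.decay ^ t * this

theorem goodProb_true_antitone : Antitone (a.goodProb true) :=
  antitone_nat_of_succ_le fun t => by
    rw [goodProb_true_succ]
    have := mul_nonneg a.β_pos.le (pow_nonneg a.decay_pos.le t)
    linarith

theorem goodProb_false_le_mul (t : ℕ) : a.goodProb false t ≤ t * a.α := by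
  induction t with
  | zero => simp [goodProb]
  | succ t ih =>
    have := mul_le_of_le_one_right a.α_pos.le
      (pow_le_one₀ (n := t) a.decay_pos.le a.decay_lt_one.le)
    rw [goodProb_false_succ, Nat.cast_succ]
    linarith

end Chain

section OptimalRate

variable (a : Arm) (lam : ℝ)

/-- Long-run average of reward minus penalty of the single-arm policy that plays when the last
observation was good or was bad `t` steps ago.  Its cycle from one bad observation to the next has
expected length `t + v_t / β` and expected gain `v_t (r - lam) / β - lam`, where
`v_t = goodProb false t`; both are multiplied by `β` here. -/
noncomputable def waitRate (t : ℕ+) : ℝ :=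
  (a.goodProb false t * (a.r - lam) - lam * a.β) / (t * a.β + a.goodProb false t)

/-- The best average of the policies that wait a fixed time after a bad observation and of the
policy that never plays.  It equals `H lam` for `0 ≤ lam`, see `H_eq_optRate`. -/
noncomputable def optRate : ℝ := ⨆ t : ℕ+, max 0 (a.waitRate lam t)

variable {a lam}

theorem goodProb_false_pos (t : ℕ+) : 0 < a.goodProb false t :=
  a.α_pos.trans_le (a.belief_mem_Icc (false, t)).1

theorem cycle_pos (t : ℕ+) : 0 < t * a.β + a.goodProb false t := by
  have := mul_pos (Nat.cast_pos.2 t.pos) a.β_pos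
  linarith [a.goodProb_false_pos t]

theorem waitRate_le_iff {t : ℕ+} {c : ℝ} : a.waitRate lam t ≤ c ↔
    a.goodProb false t * (a.r - lam) - lam * a.β ≤ c * (t * a.β + a.goodProb false t) :=
  div_le_iff₀ (cycle_pos t)

theorem waitRate_le_max (t : ℕ+) : a.waitRate lam t ≤ max 0 (a.r * (1 - a.β) - lam) := by
  have one_le_t : (1 : ℝ) ≤ t := by exact_mod_cast one_le (a := t)
  have hv := (a.belief_mem_Icc (false, t)).2
  have hv0 := a.goodProb_false_pos t
  have hβ := a.β_pos
  rw [waitRate_le_iff]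
  calc a.goodProb false t * (a.r - lam) - lam * a.β
      ≤ (a.r * (1 - a.β) - lam) * (a.β + a.goodProb false t) := by
        have := mul_nonneg (mul_nonneg a.r_nonneg hβ.le) (sub_nonneg.2 hv)
        simp only [belief] at this
        linarith
    _ ≤ max 0 (a.r * (1 - a.β) - lam) * (a.β + a.goodProb false t) := by
        gcongr
        exact le_max_right _ _
    _ ≤ max 0 (a.r * (1 - a.β) - lam) * (t * a.β + a.goodProb false t) := by
        gcongr
        exact le_mul_of_one_le_left hβ.le one_le_t

theorem bddAbove_waitRate : BddAbove (range fun t : ℕ+ => max 0 (a.waitRate lam t)) :=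
  ⟨max 0 (a.r * (1 - a.β) - lam),
    forall_mem_range.2 fun t => max_le (le_max_left _ _) (waitRate_le_max t)⟩

theorem waitRate_le_optRate (t : ℕ+) : a.waitRate lam t ≤ a.optRate lam :=
  (le_max_right _ _).trans (le_ciSup bddAbove_waitRate t)

theorem optRate_nonneg : 0 ≤ a.optRate lam :=
  (le_max_left 0 _).trans (le_ciSup bddAbove_waitRate 1)

theorem optRate_le {c : ℝ} (hc : 0 ≤ c) (h : ∀ t, a.waitRate lam t ≤ c) : a.optRate lam ≤ c :=
  ciSup_le fun t => max_le hc (h t)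

theorem optRate_le_max : a.optRate lam ≤ max 0 (a.r * (1 - a.β) - lam) :=
  optRate_le (le_max_left _ _) waitRate_le_max

theorem optRate_eq_zero (hlam : a.r * (1 - a.β) ≤ lam) : a.optRate lam = 0 :=
  (optRate_le_max.trans_eq (max_eq_left (sub_nonpos.2 hlam))).antisymm optRate_nonneg

theorem optRate_antitone : Antitone a.optRate := fun l m hlm =>
  optRate_le optRate_nonneg fun t => waitRate_le_iff.2 <| by
    have := waitRate_le_iff.1 (a.waitRate_le_optRate (lam := l) t)
    have := mul_nonneg (sub_nonneg.2 hlm) (add_nonneg (a.goodProb_false_pos t).le a.β_pos.le)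
    linarith

theorem optRate_le_add {l m : ℝ} (hlm : l ≤ m) : a.optRate l ≤ a.optRate m + (m - l) :=
  optRate_le (add_nonneg optRate_nonneg (sub_nonneg.2 hlm)) fun t => waitRate_le_iff.2 <| by
    have one_le_t : (1 : ℝ) ≤ t := by exact_mod_cast one_le (a := t)
    have := waitRate_le_iff.1 (a.waitRate_le_optRate (lam := m) t)
    have := mul_nonneg (sub_nonneg.2 hlm) (mul_nonneg (sub_nonneg.2 one_le_t) a.β_pos.le)
    linarith

theorem continuous_optRate : Continuous a.optRate :=
  (LipschitzWith.of_le_add fun l m => by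
    rcases le_total l m with hlm | hml
    · rw [dist_comm, Real.dist_eq, abs_of_nonneg (sub_nonneg.2 hlm)]
      exact optRate_le_add hlm
    · exact (optRate_antitone hml).trans (le_add_of_nonneg_right dist_nonneg)).continuous

theorem optRate_mul_le {l m : ℝ} (hlm : l ≤ m) (hm : m ≤ a.r) :
    a.optRate m * (a.r - l) ≤ a.optRate l * (a.r - m) := by
  rcases (hlm.trans hm).eq_or_lt with rfl | hl
  · simp [hm.antisymm hlm]
  have hrl := sub_pos.2 hl
  rw [← le_div_iff₀ hrl]
  refine optRate_le (div_nonneg (mul_nonneg optRate_nonneg (sub_nonneg.2 hm)) hrl.le) fun t => ?_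
  rw [waitRate_le_iff, div_mul_eq_mul_div, le_div_iff₀ hrl]
  have := mul_le_mul_of_nonneg_right (waitRate_le_iff.1 (a.waitRate_le_optRate (lam := l) t))
    (sub_nonneg.2 hm)
  have := mul_nonneg (mul_nonneg a.β_pos.le a.r_nonneg) (sub_nonneg.2 hlm)
  linarith

theorem exists_waitRate_eq_optRate (hH : 0 < a.optRate lam) :
    ∃ t, a.waitRate lam t = a.optRate lam := by
  obtain ⟨t₀, ht₀⟩ := exists_lt_of_lt_ciSup hH
  have pos : 0 < a.waitRate lam t₀ := (lt_max_iff.1 ht₀).resolve_left (lt_irrefl 0)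
  set c := a.waitRate lam t₀
  have cycle_tendsto : Tendsto (fun t : ℕ+ => c * ((t : ℝ) * a.β)) (cocompact ℕ+) atTop := by
    rw [cocompact_eq_cofinite]
    refine ((tendsto_natCast_atTop_atTop.comp ?_).atTop_mul_const a.β_pos).const_mul_atTop pos
    rw [← Nat.cofinite_eq_atTop]
    exact PNat.coe_injective.tendsto_cofinite
  obtain ⟨t, ht⟩ := continuous_of_discreteTopology.exists_forall_ge' (f := a.waitRate lam) t₀ <| by
    filter_upwards [cycle_tendsto.eventually_ge_atTop (|a.r - lam| + |lam| * a.β)] with t hcycle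
    have hv0 := a.goodProb_false_pos t
    have := mul_le_mul_of_nonneg_left (le_abs_self (a.r - lam)) hv0.le
    have := mul_le_of_le_one_left (abs_nonneg (a.r - lam)) (a.belief_le_one (false, t))
    have := mul_le_mul_of_nonneg_right (neg_le_abs lam) a.β_pos.le
    have := mul_nonneg pos.le hv0.le
    simp only [belief] at *
    exact waitRate_le_iff.2 (by linarith)
  exact ⟨t, (waitRate_le_optRate t).antisymm
    (optRate_le (pos.le.trans (ht t₀)) ht)⟩

end OptimalRate

end Arm

namespace Arm

section GoodGain

variable (a : Arm) (lam : ℝ)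

/-- Gain relative to the average `optRate` of a run of plays that starts when the arm is good and
ends when it is found bad; such a run has expected length `1 / β`. -/
noncomputable def goodGain : ℝ := (a.r - lam - a.optRate lam) / a.β

theorem goodGain_mul_beta : a.goodGain lam * a.β = a.r - lam - a.optRate lam :=
  div_mul_cancel₀ _ a.β_pos.ne'

variable {a lam}

theorem goodGain_mul_goodProb_le (t : ℕ+) :
    a.goodGain lam * a.goodProb false t ≤ lam + a.optRate lam * t := by
  refine le_of_mul_le_mul_right ?_ a.β_pos
  have := waitRate_le_iff.1 (a.waitRate_le_optRate (lam := lam) t)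
  have := congrArg (· * a.goodProb false t) (a.goodGain_mul_beta lam)
  linarith

theorem exists_goodGain_mul_goodProb_eq (hH : 0 < a.optRate lam) :
    ∃ t : ℕ+, a.goodGain lam * a.goodProb false t = lam + a.optRate lam * t := by
  obtain ⟨t, ht⟩ := exists_waitRate_eq_optRate hH
  refine ⟨t, mul_right_cancel₀ a.β_pos.ne' ?_⟩
  rw [waitRate, div_eq_iff (cycle_pos t).ne'] at ht
  linear_combination ht + a.goodProb false t * a.goodGain_mul_beta lam

theorem r_le_goodGain (hlam : lam ≤ a.r * (1 - a.β)) : a.r ≤ a.goodGain lam := by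
  have := optRate_le_max.trans_eq (max_eq_right (sub_nonneg.2 hlam))
  rw [goodGain, le_div_iff₀ a.β_pos]
  linarith

theorem goodGain_nonneg (hlam : lam ≤ a.r * (1 - a.β)) : 0 ≤ a.goodGain lam :=
  a.r_nonneg.trans (r_le_goodGain hlam)

theorem optRate_le_goodGain_mul_alpha (h0 : 0 ≤ lam) (hlam : lam ≤ a.r) :
    a.optRate lam ≤ a.goodGain lam * a.α := by
  have hαβ : 0 < a.α + a.β := add_pos a.α_pos a.β_pos
  have hr := sub_nonneg.2 hlam
  have bound : a.optRate lam ≤ a.α * (a.r - lam) / (a.α + a.β) := by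
    refine optRate_le (div_nonneg (mul_nonneg a.α_pos.le hr) hαβ.le) fun t => ?_
    rw [waitRate_le_iff, div_mul_eq_mul_div, le_div_iff₀ hαβ]
    have := mul_le_mul_of_nonneg_right (a.goodProb_false_le_mul t) (mul_nonneg hr a.β_pos.le)
    have := mul_nonneg (mul_nonneg h0 a.β_pos.le) hαβ.le
    linarith
  rw [le_div_iff₀ hαβ] at bound
  rw [goodGain, div_mul_eq_mul_div, le_div_iff₀ a.β_pos]
  linarith

end GoodGain

section StopValue

variable (a : Arm) (lam : ℝ)

/-- Gain relative to the average `optRate` when the arm is good with probability `ω`, rests for `k`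
steps, and is then played until it is found bad. -/
noncomputable def stopGain (k : ℕ) (ω : ℝ) : ℝ :=
  a.goodGain lam * a.evolve^[k] ω - lam - a.optRate lam * (k + 1)

/-- Value at the belief `ω` of the optimal stopping problem of choosing the time of the next play. -/
noncomputable def stopValue (ω : ℝ) : ℝ := ⨆ k, a.stopGain lam k ω

variable {a lam} {ω : ℝ}

theorem bddAbove_stopGain (hK : 0 ≤ a.goodGain lam) (hω : ω ∈ Icc (0 : ℝ) 1) :
    BddAbove (range fun k => a.stopGain lam k ω) := by
  refine ⟨a.goodGain lam - lam, forall_mem_range.2 fun k => ?_⟩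
  have := mul_le_of_le_one_right hK (a.evolve_iterate_mem_Icc hω k).2
  have := mul_nonneg (optRate_nonneg (a := a) (lam := lam)) k.cast_add_one_pos.le
  unfold stopGain
  linarith

theorem stopGain_le_stopValue (hK : 0 ≤ a.goodGain lam) (hω : ω ∈ Icc (0 : ℝ) 1) (k : ℕ) :
    a.stopGain lam k ω ≤ a.stopValue lam ω :=
  le_ciSup (bddAbove_stopGain hK hω) k

theorem stopGain_succ (k : ℕ) :
    a.stopGain lam (k + 1) ω = a.stopGain lam k (a.evolve ω) - a.optRate lam := by
  simp only [stopGain, Function.iterate_succ_apply, Nat.cast_succ]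
  ring

theorem optRate_add_stopValue (hK : 0 ≤ a.goodGain lam) (hω : ω ∈ Icc (0 : ℝ) 1) :
    a.optRate lam + a.stopValue lam ω =
      max (a.goodGain lam * ω - lam) (a.stopValue lam (a.evolve ω)) := by
  have gain_zero : a.stopGain lam 0 ω = a.goodGain lam * ω - lam - a.optRate lam := by
    simp [stopGain]
  have hω' := a.Icc_alpha_subset (a.evolve_mem_Icc hω)
  refine le_antisymm ?_ (max_le ?_ (ciSup_le fun k => ?_))
  · rw [← le_sub_iff_add_le']
    refine ciSup_le fun k => ?_
    rw [le_sub_iff_add_le']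
    cases k with
    | zero => exact le_max_of_le_left (by linarith)
    | succ k =>
      have := stopGain_le_stopValue hK hω' k
      exact le_max_of_le_right (by linarith [a.stopGain_succ (lam := lam) (ω := ω) k])
  · linarith [stopGain_le_stopValue hK hω 0]
  · linarith [stopGain_le_stopValue hK hω (k + 1), a.stopGain_succ (lam := lam) (ω := ω) k]

theorem stopGain_alpha (k : ℕ) : a.stopGain lam k a.α =
    a.goodGain lam * a.goodProb false (k + 1) - (lam + a.optRate lam * (k + 1)) := by
  rw [stopGain, ← a.belief_bad_one, belief, PNat.one_coe, evolve_iterate_goodProb, add_comm 1]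
  ring

theorem stopValue_alpha_nonpos : a.stopValue lam a.α ≤ 0 :=
  ciSup_le fun k => by
    rw [stopGain_alpha, sub_nonpos]
    exact_mod_cast a.goodGain_mul_goodProb_le k.succPNat

theorem stopValue_alpha (hK : 0 ≤ a.goodGain lam) (hH : 0 < a.optRate lam) :
    a.stopValue lam a.α = 0 := by
  refine stopValue_alpha_nonpos.antisymm ?_
  obtain ⟨t, ht⟩ := exists_goodGain_mul_goodProb_eq hH
  have := stopGain_le_stopValue (lam := lam) hK
    (a.Icc_alpha_subset ⟨le_rfl, by linarith [a.bursty]⟩) t.natPred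
  rwa [stopGain_alpha, ← Nat.cast_succ, Nat.succ_eq_add_one, PNat.natPred_add_one, ht,
    sub_self] at this

theorem stopValue_one_sub_beta (hK : 0 ≤ a.goodGain lam) :
    a.stopValue lam (1 - a.β) = a.goodGain lam - a.r := by
  have gain (k : ℕ) : a.stopGain lam k (1 - a.β) =
      a.goodGain lam * a.goodProb true (k + 1) - lam - a.optRate lam * (k + 1) := by
    rw [stopGain, ← a.belief_good_one, belief, PNat.one_coe, evolve_iterate_goodProb, add_comm 1]
  have gain_zero : a.stopGain lam 0 (1 - a.β) = a.goodGain lam - a.r := by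
    simp only [stopGain, Function.iterate_zero_apply, Nat.cast_zero]
    linear_combination -a.goodGain_mul_beta lam
  refine le_antisymm (ciSup_le fun k => ?_) ?_
  · rw [← gain_zero, gain, gain]
    have := mul_le_mul_of_nonneg_left
      (a.goodProb_true_antitone (Nat.add_le_add_right k.zero_le 1)) hK
    have := mul_nonneg (optRate_nonneg (a := a) (lam := lam)) k.cast_nonneg
    push_cast
    linarith
  · rw [← gain_zero]
    exact stopGain_le_stopValue hK (a.Icc_alpha_subset ⟨by linarith [a.bursty], le_rfl⟩) 0

theorem continuousOn_stopValue (hK : 0 ≤ a.goodGain lam) :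
    ContinuousOn (a.stopValue lam) (Icc 0 1) :=
  (LipschitzOnWith.of_le_add_mul (a.goodGain lam).toNNReal fun ω _ ω' hω' => by
    rw [Real.coe_toNNReal _ hK]
    refine ciSup_le fun k => ?_
    have hdecay : a.decay ^ k * (ω - ω') ≤ dist ω ω' := calc
      a.decay ^ k * (ω - ω') ≤ a.decay ^ k * |ω - ω'| :=
        mul_le_mul_of_nonneg_left (le_abs_self _) (pow_nonneg a.decay_pos.le k)
      _ ≤ |ω - ω'| := mul_le_of_le_one_left (abs_nonneg _)
        (pow_le_one₀ a.decay_pos.le a.decay_lt_one.le)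
    have := stopGain_le_stopValue hK hω' k
    have := mul_le_mul_of_nonneg_left hdecay hK
    rw [← evolve_iterate_sub] at this
    unfold stopGain at *
    linarith).continuousOn

end StopValue

end Arm

namespace Arm

variable {a : Arm} {lam : ℝ}

/-- `V` solves the Bellman inequalities of the single-arm problem for the average `optRate`: a
certificate that no policy has a larger average. -/
structure IsBellmanBound (a : Arm) (lam : ℝ) (V : InfoState → ℝ) : Prop where
  nonneg : ∀ x, 0 ≤ V x
  play_le : ∀ x, a.infoPlayValue V x - lam ≤ a.optRate lam + V x
  rest_le : ∀ x, V x.aged ≤ a.optRate lam + V x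

theorem infoPlayValue_eq_goodGain_mul {V : InfoState → ℝ}
    (hgood : V (true, 1) = a.goodGain lam - a.r) (hbad : V (false, 1) = 0) (x : InfoState) :
    a.infoPlayValue V x = a.goodGain lam * a.belief x := by
  rw [infoPlayValue, hgood, hbad]
  ring

theorem isBellmanBound_stopValue (hlam : lam ≤ a.r * (1 - a.β)) :
    a.IsBellmanBound lam fun x => max 0 (a.stopValue lam (a.belief x)) := by
  have hK := goodGain_nonneg hlam
  have bellman (x : InfoState) :=
    optRate_add_stopValue hK (a.Icc_alpha_subset (a.belief_mem_Icc x))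
  refine ⟨fun x => le_max_left _ _, fun x => ?_, fun x => max_le ?_ ?_⟩
  · rw [infoPlayValue_eq_goodGain_mul (lam := lam)]
    · exact (le_max_left _ _).trans ((bellman x).symm.trans_le
        (add_le_add_right (le_max_right _ _) _))
    · rw [belief_good_one, stopValue_one_sub_beta hK,
        max_eq_right (sub_nonneg.2 (r_le_goodGain hlam))]
    · rw [belief_bad_one, max_eq_left stopValue_alpha_nonpos]
  · exact add_nonneg optRate_nonneg (le_max_left _ _)
  · exact (le_max_right _ _).trans ((bellman x).symm.trans_le
      (add_le_add_right (le_max_right _ _) _))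

theorem isBellmanBound_zero (hlam : a.r * (1 - a.β) ≤ lam) : a.IsBellmanBound lam fun _ => 0 where
  nonneg _ := le_rfl
  play_le x := by
    have := mul_le_mul_of_nonneg_left (a.belief_mem_Icc x).2 a.r_nonneg
    have := optRate_nonneg (a := a) (lam := lam)
    unfold infoPlayValue
    linarith
  rest_le _ := add_nonneg optRate_nonneg le_rfl

theorem exists_isBellmanBound (a : Arm) (lam : ℝ) : ∃ V, a.IsBellmanBound lam V :=
  (le_total lam (a.r * (1 - a.β))).elim (fun h => ⟨_, isBellmanBound_stopValue h⟩)
    fun h => ⟨_, isBellmanBound_zero h⟩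

end Arm

-- Lagrangian relaxation: the gap `lam - μ` is paid in every step, whether or not an arm is played.
theorem exists_total_le {ι : Type} [Fintype ι] [DecidableEq ι] (arms : ι → Arm) {lam μ : ℝ}
    (hμ : μ ≤ lam) (x : ι → InfoState) (σ : Policy ι) :
    ∃ C, ∀ T : ℕ, total arms μ x σ T ≤ (lam - μ + ∑ i, (arms i).optRate lam) * T + C := by
  choose V hV using fun i => (arms i).exists_isBellmanBound lam
  have drift : ∀ h, ∀ c ∈ (σ h).support,
      lookahead arms μ x (fun h => ∑ i, V i (infoAfter x h i)) h c ≤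
        (lam - μ + ∑ i, (arms i).optRate lam) + ∑ i, V i (infoAfter x h i) := by
    rintro h (_ | j) -
    · rw [lookahead_sum_none, add_assoc, ← Finset.sum_add_distrib]
      exact le_add_of_nonneg_of_le (sub_nonneg.2 hμ)
        (Finset.sum_le_sum fun i _ => (hV i).rest_le _)
    · rw [lookahead_sum_some, add_assoc, ← Finset.sum_add_distrib,
        ← Finset.add_sum_erase _ _ (Finset.mem_univ j)]
      have others := Finset.sum_le_sum fun i (_ : i ∈ Finset.univ.erase j) =>
        (hV i).rest_le (infoAfter x h i)
      linarith [(hV j).play_le (infoAfter x h j)]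
  refine ⟨∑ i, V i (x i), fun T => ?_⟩
  have := totalAfter_le_of_lookahead_le (m := 0)
    (fun h => Finset.sum_nonneg fun i _ => (hV i).nonneg _) drift T []
  rwa [sub_zero, add_comm] at this

namespace Arm

section WaitValue

variable (a : Arm) (lam : ℝ)

/-- Potential of the policy that plays in good states, and in `(b, t)` once the marginal gain
`goodGain * α * decay ^ t` of one more step of waiting has dropped to the average `optRate`.  The
value at `(g, t)` with `1 < t` is smaller than the relative value of this policy: only information
that is given initially leads there, and a constant value makes resting free of charge. -/
noncomputable def waitValue : InfoState → ℝ
  | (false, t) =>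
    ∑ s ∈ Finset.Ico 1 (t : ℕ), min (a.optRate lam) (a.goodGain lam * (a.α * a.decay ^ s))
  | (true, t) => if t = 1 then a.goodGain lam - a.r else -(lam + a.optRate lam)

variable {a lam}

theorem waitValue_bad_succ (t : ℕ+) : a.waitValue lam (false, t + 1) =
    a.waitValue lam (false, t) +
      min (a.optRate lam) (a.goodGain lam * (a.α * a.decay ^ (t : ℕ))) :=
  Finset.sum_Ico_succ_top t.pos _

theorem waitValue_bad_one : a.waitValue lam (false, 1) = 0 := by
  simp [waitValue]

theorem waitValue_good_one : a.waitValue lam (true, 1) = a.goodGain lam - a.r := by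
  simp [waitValue]

theorem waitValue_good_of_ne_one {t : ℕ+} (ht : t ≠ 1) :
    a.waitValue lam (true, t) = -(lam + a.optRate lam) := by
  simp [waitValue, ht]

theorem infoPlayValue_waitValue (x : InfoState) :
    a.infoPlayValue (a.waitValue lam) x = a.goodGain lam * a.belief x :=
  infoPlayValue_eq_goodGain_mul waitValue_good_one waitValue_bad_one x

theorem waitValue_bad_le_mul (t : ℕ+) :
    a.waitValue lam (false, t) ≤ a.optRate lam * (t - 1) := by
  refine (Finset.sum_le_card_nsmul _ _ _ fun s _ => min_le_left _ _).trans_eq ?_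
  rw [Nat.card_Ico, nsmul_eq_mul, Nat.cast_pred t.pos, mul_comm]

theorem waitValue_bad_add_optRate {t : ℕ+}
    (hwait : a.optRate lam ≤ a.goodGain lam * (a.α * a.decay ^ (t : ℕ))) :
    a.waitValue lam (false, t + 1) = a.waitValue lam (false, t) + a.optRate lam := by
  rw [waitValue_bad_succ, min_eq_left hwait]

theorem monotone_goodGain_mul_sub_waitValue_bad :
    Monotone fun t : ℕ+ => a.goodGain lam * a.goodProb false t - a.waitValue lam (false, t) :=
  monotone_of_le_succ fun t _ => by
    have := min_le_right (a.optRate lam) (a.goodGain lam * (a.α * a.decay ^ (t : ℕ)))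
    rw [Order.succ_eq_add_one, waitValue_bad_succ, PNat.add_coe, PNat.one_coe,
      goodProb_false_succ]
    linarith

theorem waitValue_bad_nonneg (hK : 0 ≤ a.goodGain lam) (t : ℕ+) :
    0 ≤ a.waitValue lam (false, t) :=
  Finset.sum_nonneg fun s _ => le_min optRate_nonneg
    (mul_nonneg hK (mul_nonneg a.α_pos.le (pow_nonneg a.decay_pos.le s)))

theorem waitValue_bad_le_succ (hK : 0 ≤ a.goodGain lam) (t : ℕ+) :
    a.waitValue lam (false, t) ≤ a.waitValue lam (false, t + 1) := by
  rw [waitValue_bad_succ]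
  exact le_add_of_nonneg_right (le_min optRate_nonneg
    (mul_nonneg hK (mul_nonneg a.α_pos.le (pow_nonneg a.decay_pos.le _))))

theorem goodGain_mul_goodProb_le_of_le_optRate (hK : 0 ≤ a.goodGain lam) {t : ℕ}
    (hplay : a.goodGain lam * (a.α * a.decay ^ t) ≤ a.optRate lam) {s : ℕ} (hts : t ≤ s) :
    a.goodGain lam * a.goodProb false s ≤
      a.goodGain lam * a.goodProb false t + a.optRate lam * (s - t) := by
  induction s, hts using Nat.le_induction with
  | base => simp
  | succ s hts ih =>
    have := mul_le_mul_of_nonneg_left (a.decay_pow_le_decay_pow hts) (mul_nonneg hK a.α_pos.le)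
    rw [goodProb_false_succ, Nat.cast_succ]
    linarith

theorem le_goodGain_mul_of_le_optRate (hK : 0 ≤ a.goodGain lam) (hH : 0 < a.optRate lam) {t : ℕ+}
    (hplay : a.goodGain lam * (a.α * a.decay ^ (t : ℕ)) ≤ a.optRate lam) :
    lam + a.optRate lam + a.waitValue lam (false, t) ≤ a.goodGain lam * a.goodProb false t := by
  obtain ⟨n, hn⟩ := exists_goodGain_mul_goodProb_eq hH
  rcases le_total n t with hnt | htn
  · have := a.monotone_goodGain_mul_sub_waitValue_bad (lam := lam) hnt
    linarith [a.waitValue_bad_le_mul (lam := lam) n]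
  · have := goodGain_mul_goodProb_le_of_le_optRate hK hplay (PNat.coe_le_coe _ _ |>.2 htn)
    linarith [a.waitValue_bad_le_mul (lam := lam) t]

theorem lam_add_optRate_add_waitValue_good_le (hlam : lam ≤ a.r * (1 - a.β)) (t : ℕ+) :
    lam + a.optRate lam + a.waitValue lam (true, t) ≤ a.goodGain lam * a.goodProb true t := by
  rcases eq_or_ne t 1 with rfl | ht
  · change _ ≤ a.goodGain lam * a.belief (true, 1)
    rw [waitValue_good_one, belief_good_one]
    linarith [a.goodGain_mul_beta lam]
  · have := mul_nonneg (goodGain_nonneg hlam) (a.belief_nonneg (true, t))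
    rw [waitValue_good_of_ne_one ht]
    simpa [belief] using this

section SmallPenalty

variable (h0 : 0 ≤ lam) (hlam : lam ≤ a.r * (1 - a.β))

include h0 hlam

theorem optRate_add_waitValue_bad_le (t : ℕ+) :
    a.optRate lam + a.waitValue lam (false, t) ≤ a.goodGain lam * a.goodProb false t := by
  have base := optRate_le_goodGain_mul_alpha h0
    (hlam.trans (mul_le_of_le_one_right a.r_nonneg (sub_le_self 1 a.β_pos.le)))
  have mono := a.monotone_goodGain_mul_sub_waitValue_bad (lam := lam) (one_le (a := t))
  simp only [waitValue_bad_one, PNat.one_coe] at mono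
  have : a.goodProb false 1 = a.α := a.belief_bad_one
  rw [this] at mono
  linarith

theorem lam_add_optRate_add_waitValue_bad_le {t : ℕ+}
    (hplay : a.goodGain lam * (a.α * a.decay ^ (t : ℕ)) ≤ a.optRate lam) :
    lam + a.optRate lam + a.waitValue lam (false, t) ≤ a.goodGain lam * a.goodProb false t := by
  have hK := goodGain_nonneg hlam
  rcases (optRate_nonneg (a := a) (lam := lam)).eq_or_lt with hH | hH
  · have hK0 : a.goodGain lam = 0 := hK.antisymm' <| by
      have hpos := mul_pos a.α_pos (pow_pos a.decay_pos (t : ℕ))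
      exact nonpos_of_mul_nonpos_left (hplay.trans_eq hH.symm) hpos
    have hr : a.r = 0 := (r_le_goodGain hlam |>.trans_eq hK0).antisymm a.r_nonneg
    have := optRate_add_waitValue_bad_le h0 hlam t
    have : lam ≤ 0 := by simpa [hr] using hlam
    linarith
  · exact le_goodGain_mul_of_le_optRate hK hH hplay

theorem optRate_add_waitValue_le (x : InfoState) :
    a.optRate lam + a.waitValue lam x ≤ a.infoPlayValue (a.waitValue lam) x := by
  rw [infoPlayValue_waitValue]
  obtain ⟨_ | _, t⟩ := x
  · exact optRate_add_waitValue_bad_le h0 hlam t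
  · exact (by linarith : _ ≤ lam + a.optRate lam + a.waitValue lam (true, t)).trans
      (lam_add_optRate_add_waitValue_good_le hlam t)

theorem abs_waitValue_le (x : InfoState) :
    |a.waitValue lam x| ≤ a.goodGain lam + lam + a.optRate lam := by
  have hH := optRate_nonneg (a := a) (lam := lam)
  have hK := goodGain_nonneg hlam
  obtain ⟨_ | _, t⟩ := x
  · have := optRate_add_waitValue_bad_le h0 hlam t
    have := mul_le_of_le_one_right hK (a.belief_le_one (false, t))
    simp only [belief] at this
    rw [abs_of_nonneg (waitValue_bad_nonneg hK t)]
    linarith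
  · rcases eq_or_ne t 1 with rfl | ht
    · rw [waitValue_good_one, abs_of_nonneg (sub_nonneg.2 (r_le_goodGain hlam))]
      linarith [a.r_nonneg]
    · rw [waitValue_good_of_ne_one ht, abs_neg, abs_of_nonneg (add_nonneg h0 hH)]
      linarith

end SmallPenalty

end WaitValue

end Arm

theorem total_pure_none {ι : Type} [Fintype ι] [DecidableEq ι] (arms : ι → Arm) (lam : ℝ)
    (x : ι → InfoState) (T : ℕ) : total arms lam x (fun _ => PMF.pure none) T = 0 := by
  have lookahead_eq (h : History ι) (c) (hc : c ∈ (PMF.pure (none : Option ι)).support) :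
      lookahead arms lam x (fun _ => 0) h c = 0 := by
    rw [(PMF.mem_support_pure_iff _ _).1 hc]
    rfl
  refine le_antisymm ?_ ?_
  · simpa [total_eq_totalAfter] using totalAfter_le_of_lookahead_le (c := 0) (m := 0)
      (fun _ => le_rfl) (fun h c hc => by simpa using (lookahead_eq h c hc).le) T []
  · simpa [total_eq_totalAfter] using le_totalAfter_of_le_lookahead (c := 0) (M := 0)
      (fun _ => le_rfl) (fun h c hc => by simpa using (lookahead_eq h c hc).ge) T []

namespace Arm

variable (a : Arm) {lam : ℝ}

theorem H_nonneg (lam : ℝ) : 0 ≤ a.H lam :=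
  Real.sSup_nonneg' ⟨0, ⟨(false, 1), fun _ => PMF.pure none, by simp [total_pure_none]⟩, le_rfl⟩

/-- The actions of the single-arm policy behind `waitValue`. -/
noncomputable def waitAction (lam : ℝ) : InfoState → Option Unit
  | (true, _) => some ()
  | (false, t) =>
    if a.goodGain lam * (a.α * a.decay ^ (t : ℕ)) ≤ a.optRate lam then some () else none

/-- The policy behind `waitValue` for an arm that is initially in the state `(b, 1)`. -/
noncomputable def waitPolicy (lam : ℝ) : Policy Unit := fun h =>
  PMF.pure (a.waitAction lam (infoAfter (fun _ => (false, 1)) h ()))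

variable {a}

theorem le_lookahead_waitAction (h0 : 0 ≤ lam) (hlam : lam ≤ a.r * (1 - a.β))
    (x : Unit → InfoState) (h : History Unit) :
    a.optRate lam + a.waitValue lam (infoAfter x h ()) ≤
      lookahead (fun _ => a) lam x (fun h => a.waitValue lam (infoAfter x h ())) h
        (a.waitAction lam (infoAfter x h ())) := by
  have lookahead_play : lookahead (fun _ => a) lam x
      (fun h => a.waitValue lam (infoAfter x h ())) h (some ()) =
        a.goodGain lam * a.belief (infoAfter x h ()) - lam := by
    rw [← infoPlayValue_waitValue]
    rfl
  have lookahead_rest : lookahead (fun _ => a) lam x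
      (fun h => a.waitValue lam (infoAfter x h ())) h none =
        a.waitValue lam (infoAfter x h ()).aged := rfl
  generalize infoAfter x h () = y at *
  obtain ⟨_ | _, t⟩ := y
  · simp only [waitAction]
    split_ifs with hplay
    · rw [lookahead_play]
      exact le_sub_iff_add_le'.2 ((add_assoc ..).symm.trans_le
        (lam_add_optRate_add_waitValue_bad_le h0 hlam hplay))
    · rw [lookahead_rest, waitValue_bad_add_optRate (not_le.1 hplay).le, add_comm]
  · rw [waitAction, lookahead_play]
    exact le_sub_iff_add_le'.2 ((add_assoc ..).symm.trans_le
      (lam_add_optRate_add_waitValue_good_le hlam t))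

theorem exists_le_total_waitPolicy (h0 : 0 ≤ lam) (hlam : lam ≤ a.r * (1 - a.β)) :
    ∃ C, ∀ T : ℕ, a.optRate lam * T + C ≤
      total (fun _ : Unit => a) lam (fun _ => (false, 1)) (a.waitPolicy lam) T := by
  refine ⟨a.waitValue lam (false, 1) - (a.goodGain lam + lam + a.optRate lam), fun T => ?_⟩
  have := le_totalAfter_of_le_lookahead (c := a.optRate lam)
    (fun h => (abs_le.1 (abs_waitValue_le h0 hlam (infoAfter (fun _ => (false, 1)) h ()))).2)
    (fun h c hc => by
      rw [(PMF.mem_support_pure_iff _ _).1 hc]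
      exact le_lookahead_waitAction h0 hlam _ h) T []
  rw [total_eq_totalAfter]
  exact (by simp only [infoAfter]; linarith : _ ≤ _).trans this

theorem H_eq_optRate (h0 : 0 ≤ lam) : a.H lam = a.optRate lam := by
  have growth_le (x : InfoState) (π : Policy Unit) : ∃ C, ∀ T : ℕ,
      total (fun _ : Unit => a) lam (fun _ => x) π T ≤ a.optRate lam * T + C := by
    simpa using exists_total_le (fun _ : Unit => a) (le_refl lam) (fun _ => x) π
  have le_growth : ∃ (x : InfoState) (π : Policy Unit) (C : ℝ), ∀ T : ℕ,
      a.optRate lam * T + C ≤ total (fun _ : Unit => a) lam (fun _ => x) π T := by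
    rcases le_total lam (a.r * (1 - a.β)) with hlam | hlam
    · exact ⟨_, _, exists_le_total_waitPolicy h0 hlam⟩
    · exact ⟨(false, 1), fun _ => PMF.pure none, 0, fun T => by
        simp [total_pure_none, optRate_eq_zero hlam]⟩
  have liminf_le (x : InfoState) (π : Policy Unit) : liminf (fun T : ℕ =>
      total (fun _ : Unit => a) lam (fun _ => x) π T / (T : ℝ)) atTop ≤ a.optRate lam := by
    obtain ⟨C, hC⟩ := growth_le x π
    exact liminf_div_nat_le (D := 0) (fun T => by
      rw [add_zero]
      exact neg_abs_mul_le_total _ lam _ π T) hC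
  obtain ⟨x, π, D, hD⟩ := le_growth
  obtain ⟨C, hC⟩ := growth_le x π
  refine IsGreatest.csSup_eq ⟨⟨x, π, ?_⟩, ?_⟩
  · exact (le_liminf_div_nat hD hC).antisymm (liminf_le x π)
  · rintro c ⟨x, π, rfl⟩
    exact liminf_le x π

end Arm

namespace Arm

variable {a : Arm} {lam : ℝ}

section LargePenalty

variable (a) in
theorem tendsto_goodProb (s : Bool) :
    Tendsto (a.goodProb s) atTop (𝓝 (a.α / (a.α + a.β))) := by
  have fixed : a.evolve (a.α / (a.α + a.β)) = a.α / (a.α + a.β) := by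
    have : a.α + a.β ≠ 0 := (add_pos a.α_pos a.β_pos).ne'
    simp only [evolve]
    field_simp
    ring
  have closed_form (t : ℕ) : a.goodProb s t =
      a.decay ^ t * (a.goodProb s 0 - a.α / (a.α + a.β)) + a.α / (a.α + a.β) := by
    rw [← evolve_iterate_sub, evolve_iterate_goodProb, zero_add, Function.iterate_fixed fixed,
      sub_add_cancel]
  have limit := ((tendsto_pow_atTop_nhds_zero_of_lt_one a.decay_pos.le a.decay_lt_one).mul_const
    (a.goodProb s 0 - a.α / (a.α + a.β))).add_const (a.α / (a.α + a.β))
  rw [zero_mul, zero_add] at limit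
  exact limit.congr fun t => (closed_form t).symm

variable {V : ℝ → ℝ}

theorem IsRelativeValue.tendsto_goodProb (hV : a.IsRelativeValue lam V) (s : Bool) :
    Tendsto (fun t => V (a.goodProb s t)) atTop (𝓝 (V (a.α / (a.α + a.β)))) :=
  have stationary_mem : a.α / (a.α + a.β) ∈ Icc (0 : ℝ) 1 :=
    isClosed_Icc.mem_of_tendsto (a.tendsto_goodProb s) (.of_forall (a.goodProb_mem_Icc s))
  (hV.1 _ stationary_mem).tendsto.comp (tendsto_nhdsWithin_iff.2
    ⟨a.tendsto_goodProb s, .of_forall (a.goodProb_mem_Icc s)⟩)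

theorem IsRelativeValue.eq_max_of_le (hV : a.IsRelativeValue lam V) (hlam : a.r * (1 - a.β) ≤ lam)
    {ω : ℝ} (hω : ω ∈ Icc (0 : ℝ) 1) :
    V ω = max (a.playValue lam V ω) (V (a.evolve ω)) := by
  have hr := mul_nonneg a.r_nonneg (a.belief_nonneg (true, 1))
  rw [belief_good_one] at hr
  have := hV.2 ω hω
  rwa [H_eq_optRate (hr.trans hlam), optRate_eq_zero hlam, zero_add] at this

theorem IsRelativeValue.stationary_le (hV : a.IsRelativeValue lam V)
    (hlam : a.r * (1 - a.β) ≤ lam) (s : Bool) (t : ℕ) :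
    V (a.α / (a.α + a.β)) ≤ V (a.goodProb s t) :=
  Antitone.le_of_tendsto (f := fun t => V (a.goodProb s t))
    (antitone_nat_of_succ_le fun t =>
      (le_max_right _ _).trans_eq (hV.eq_max_of_le hlam (a.goodProb_mem_Icc s t)).symm)
    (hV.tendsto_goodProb s) t

theorem playValue_lt (V : ℝ → ℝ) (hlam : a.r * (1 - a.β) < lam) {ω : ℝ}
    (hω : ω ∈ Icc a.α (1 - a.β)) : a.playValue lam V ω < max (V a.α) (V (1 - a.β)) := by
  have hω' := a.Icc_alpha_subset hω
  have := mul_le_mul_of_nonneg_left (le_max_right (V a.α) (V (1 - a.β))) hω'.1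
  have := mul_le_mul_of_nonneg_left (le_max_left (V a.α) (V (1 - a.β))) (sub_nonneg.2 hω'.2)
  have := mul_le_mul_of_nonneg_left hω.2 a.r_nonneg
  simp only [playValue]
  linarith

theorem IsRelativeValue.max_le_stationary (hV : a.IsRelativeValue lam V)
    (hlam : a.r * (1 - a.β) < lam) :
    max (V a.α) (V (1 - a.β)) ≤ V (a.α / (a.α + a.β)) := by
  obtain ⟨s, hs⟩ : ∃ s, max (V a.α) (V (1 - a.β)) ≤ V (a.belief (s, 1)) := by
    rcases max_choice (V a.α) (V (1 - a.β)) with h | h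
    · exact ⟨false, by rw [h, belief_bad_one]⟩
    · exact ⟨true, by rw [h, belief_good_one]⟩
  have le_value (t : ℕ) : max (V a.α) (V (1 - a.β)) ≤ V (a.goodProb s (t + 1)) := by
    induction t with
    | zero => exact hs
    | succ t ih =>
      rw [hV.eq_max_of_le hlam.le (a.goodProb_mem_Icc s (t + 1))] at ih
      exact (le_max_iff.1 ih).resolve_left
        (playValue_lt V hlam (a.evolve_mem_Icc (a.goodProb_mem_Icc s t))).not_ge
  exact ge_of_tendsto ((hV.tendsto_goodProb s).comp (tendsto_add_atTop_nat 1))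
    (.of_forall le_value)

-- The value at every belief is at least the stationary value, which is the largest value that a
-- play can lead to; a play therefore gains less than its penalty.
theorem not_playOptimal (hlam : a.r * (1 - a.β) < lam) (x : InfoState) :
    ¬ a.PlayOptimal lam x := by
  rintro ⟨V, hV, hplay⟩
  exact ((hV.max_le_stationary hlam).trans <|
    (hV.stationary_le hlam.le x.1 (x.2 + 1)).trans hplay).not_gt
      (playValue_lt V hlam (a.belief_mem_Icc x))

theorem PlayOptimal.le_myopic {x : InfoState} (h : a.PlayOptimal lam x) :
    lam ≤ a.r * (1 - a.β) :=
  not_lt.1 fun hlt => not_playOptimal hlt x h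

variable (a) in
theorem whittleIndex_le (x : InfoState) : a.whittleIndex x ≤ a.r * (1 - a.β) := by
  refine Real.sSup_le (fun _ h => h.le_myopic) ?_
  rw [← belief_good_one]
  exact mul_nonneg a.r_nonneg (a.belief_nonneg _)

theorem PlayOptimal.le_whittleIndex {x : InfoState} (h : a.PlayOptimal lam x) :
    lam ≤ a.whittleIndex x :=
  le_csSup ⟨_, fun _ h => h.le_myopic⟩ h

end LargePenalty

section IndexLowerBound

theorem stopGain_evolve_belief (x : InfoState) (k : ℕ) :
    a.stopGain lam k (a.evolve (a.belief x)) =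
      a.goodGain lam * a.goodProb x.1 (x.2 + (k + 1)) - lam - a.optRate lam * (k + 1) := by
  rw [stopGain, ← Function.iterate_succ_apply, belief, evolve_iterate_goodProb]

theorem playOptimal_of_goodProb_le (h0 : 0 ≤ lam) (hH : 0 < a.optRate lam) {x : InfoState}
    (hx : ∀ k : ℕ, a.goodGain lam * a.goodProb x.1 (x.2 + (k + 1)) ≤
      a.goodGain lam * a.belief x + a.optRate lam * (k + 1)) : a.PlayOptimal lam x := by
  have hlam : lam ≤ a.r * (1 - a.β) := not_lt.1 fun h => hH.ne' (optRate_eq_zero h.le)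
  have hK := goodGain_nonneg hlam
  have playValue_eq (ω : ℝ) :
      a.playValue lam (a.stopValue lam) ω = a.goodGain lam * ω - lam := by
    rw [playValue, stopValue_alpha hK hH, stopValue_one_sub_beta hK]
    ring
  refine ⟨a.stopValue lam, ⟨continuousOn_stopValue hK, fun ω hω => ?_⟩, ?_⟩
  · rw [H_eq_optRate h0, playValue_eq, optRate_add_stopValue hK hω]
    rfl
  · rw [playValue_eq]
    refine ciSup_le fun k => ?_
    rw [stopGain_evolve_belief]
    linarith [hx k]

theorem playOptimal_good (h0 : 0 ≤ lam) (hH : 0 < a.optRate lam) (t : ℕ+) :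
    a.PlayOptimal lam (true, t) :=
  playOptimal_of_goodProb_le h0 hH fun k => by
    have hK := goodGain_nonneg (not_lt.1 fun h => hH.ne' (optRate_eq_zero h.le))
    exact (mul_le_mul_of_nonneg_left (a.goodProb_true_antitone (Nat.le_add_right t _)) hK).trans
      (le_add_of_nonneg_right (mul_nonneg hH.le k.cast_add_one_pos.le))

theorem playOptimal_bad (h0 : 0 ≤ lam) (hH : 0 < a.optRate lam) {t : ℕ+}
    (hplay : a.goodGain lam * (a.α * a.decay ^ (t : ℕ)) ≤ a.optRate lam) :
    a.PlayOptimal lam (false, t) :=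
  playOptimal_of_goodProb_le h0 hH fun k => by
    have hK := goodGain_nonneg (not_lt.1 fun h => hH.ne' (optRate_eq_zero h.le))
    have := goodGain_mul_goodProb_le_of_le_optRate hK hplay (Nat.le_add_right t (k + 1))
    push_cast at this
    rwa [add_sub_cancel_left] at this

end IndexLowerBound

section IndexUpperBound

theorem goodGain_mul_le_iff {p c : ℝ} :
    a.goodGain lam * p ≤ c ↔ p * (a.r - lam - a.optRate lam) ≤ c * a.β := by
  rw [goodGain, div_mul_eq_mul_div, div_le_iff₀ a.β_pos, mul_comm p]

theorem PlayOptimal.goodGain_mul_le (h0 : 0 ≤ lam) {t : ℕ+} (h : a.PlayOptimal lam (false, t)) :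
    a.goodGain lam * (a.α * a.decay ^ (t : ℕ)) ≤ a.optRate lam := by
  obtain ⟨V, ⟨-, bellman⟩, hplay⟩ := h
  rw [H_eq_optRate h0] at bellman
  have value_le {ω : ℝ} (hω : ω ∈ Icc a.α (1 - a.β)) :=
    (le_max_left _ _).trans (bellman ω (a.Icc_alpha_subset hω)).ge
  have play_good := value_le (a.belief_mem_Icc (true, 1))
  have play_aged := (value_le (a.belief_mem_Icc (false, t + 1))).trans
    (add_le_add_right hplay _)
  have belief_aged_eq : a.belief (false, t + 1) = a.belief (false, t) + a.α * a.decay ^ (t : ℕ) :=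
    a.goodProb_false_succ t
  rw [belief_good_one] at play_good
  rw [belief_aged_eq] at play_aged
  simp only [playValue] at play_good play_aged
  set p := a.α * a.decay ^ (t : ℕ)
  have hp : 0 ≤ p := mul_nonneg a.α_pos.le (pow_nonneg a.decay_pos.le _)
  rw [goodGain_mul_le_iff]
  calc p * (a.r - lam - a.optRate lam) ≤ p * (a.β * (a.r + V (1 - a.β) - V a.α)) :=
        mul_le_mul_of_nonneg_left (by linarith) hp
    _ = p * (a.r + V (1 - a.β) - V a.α) * a.β := by ring
    _ ≤ a.optRate lam * a.β := mul_le_mul_of_nonneg_right (by linarith) a.β_pos.le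

theorem optRate_lt_goodGain_mul_of_le {l m p : ℝ} (hp : 0 ≤ p) (hlm : l ≤ m) (hm : m < a.r)
    (hl : a.optRate l < a.goodGain l * p) : a.optRate m < a.goodGain m * p := by
  rw [← not_le, goodGain_mul_le_iff, not_le] at hl ⊢
  refine lt_of_mul_lt_mul_right ?_ (sub_pos.2 (hlm.trans_lt hm)).le
  have := mul_le_mul_of_nonneg_left (optRate_mul_le hlm hm.le) (add_nonneg hp a.β_pos.le)
  have := mul_lt_mul_of_pos_right hl (sub_pos.2 hm)
  linarith

theorem whittleIndex_bad_lt (hpos : 0 < lam) (hlam : lam ≤ a.r * (1 - a.β)) {t : ℕ+}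
    (hwait : a.optRate lam < a.goodGain lam * (a.α * a.decay ^ (t : ℕ))) :
    a.whittleIndex (false, t) < lam := by
  have hp : 0 ≤ a.α * a.decay ^ (t : ℕ) := mul_nonneg a.α_pos.le (pow_nonneg a.decay_pos.le _)
  have myopic_lt : a.r * (1 - a.β) < a.r := by
    have hr : 0 < a.r := a.r_nonneg.lt_of_ne fun h => by
      rw [← h, zero_mul] at hlam
      linarith
    exact mul_lt_of_lt_one_right hr (sub_lt_self 1 a.β_pos)
  have continuous_gain : Continuous fun l => a.goodGain l * (a.α * a.decay ^ (t : ℕ)) :=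
    (((continuous_const.sub continuous_id).sub a.continuous_optRate).div_const _).mul_const _
  have eventually_wait := a.continuous_optRate.continuousAt.eventually_lt
    continuous_gain.continuousAt hwait
  obtain ⟨l, hl, hl0, hllam⟩ := ((eventually_nhdsWithin_of_eventually_nhds eventually_wait).and
    (Ioo_mem_nhdsLT hpos)).exists
  refine (Real.sSup_le (fun m hm => not_lt.1 fun hlm => ?_) hl0.le).trans_lt hllam
  exact (optRate_lt_goodGain_mul_of_le hp hlm.le (hm.le_myopic.trans_lt myopic_lt) hl).not_ge
    (hm.goodGain_mul_le (hl0.trans hlm).le)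

end IndexUpperBound

end Arm

namespace Arm

/-- The arm is in state `(g, 1)` and its myopic reward is at least the threshold: the condition of
`TopPriority` for a single arm. -/
def HasPriority (a : Arm) (lam : ℝ) (x : InfoState) : Prop :=
  x = (true, 1) ∧ lam ≤ a.r * (1 - a.β)

/-- A bounded value of information under which the Threshold-Whittle rule gains enough: a play gains
at least `optRate`, and at least `lam` if the arm has priority or an index of at least `lam`; an arm
without priority that rests loses nothing, and gains at least `optRate` if its index is smaller than
`lam`. -/
structure IsPotential (a : Arm) (lam : ℝ) (φ : InfoState → ℝ) : Prop where
  bounded : ∃ M, ∀ x, |φ x| ≤ M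
  play : ∀ x, a.optRate lam + φ x ≤ a.infoPlayValue φ x
  play_of_le_index : ∀ x, a.HasPriority lam x ∨ lam ≤ a.whittleIndex x →
    lam + φ x ≤ a.infoPlayValue φ x
  rest : ∀ x, ¬ a.HasPriority lam x → φ x ≤ φ x.aged
  rest_of_index_lt : ∀ x, ¬ a.HasPriority lam x → a.whittleIndex x < lam →
    a.optRate lam + φ x ≤ φ x.aged

variable {a : Arm} {lam : ℝ}

theorem lam_add_waitValue_le (h0 : 0 ≤ lam) (hlam : lam ≤ a.r * (1 - a.β)) {x : InfoState}
    (hx : a.HasPriority lam x ∨ lam ≤ a.whittleIndex x) :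
    lam + a.waitValue lam x ≤ a.infoPlayValue (a.waitValue lam) x := by
  have hH := optRate_nonneg (a := a) (lam := lam)
  rcases h0.eq_or_lt with rfl | hpos
  · linarith [optRate_add_waitValue_le h0 hlam x]
  rw [infoPlayValue_waitValue]
  obtain ⟨_ | _, t⟩ := x
  · have hindex : lam ≤ a.whittleIndex (false, t) := hx.resolve_left fun h => by
      simpa using congrArg Prod.fst h.1
    have hplay := not_lt.1 fun hwait => (whittleIndex_bad_lt hpos hlam hwait).not_ge hindex
    exact (add_le_add_left (le_add_of_nonneg_right hH) _).trans
      (lam_add_optRate_add_waitValue_bad_le h0 hlam hplay)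
  · exact (add_le_add_left (le_add_of_nonneg_right hH) _).trans
      (lam_add_optRate_add_waitValue_good_le hlam t)

theorem waitValue_le_aged (hlam : lam ≤ a.r * (1 - a.β)) {x : InfoState}
    (hx : ¬ a.HasPriority lam x) : a.waitValue lam x ≤ a.waitValue lam x.aged := by
  obtain ⟨_ | _, t⟩ := x
  · exact waitValue_bad_le_succ (goodGain_nonneg hlam) t
  · have ht : t ≠ 1 := fun ht => hx ⟨by rw [ht], hlam⟩
    rw [waitValue_good_of_ne_one ht, waitValue_good_of_ne_one (PNat.lt_add_left 1 t).ne']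

theorem optRate_add_waitValue_le_aged (h0 : 0 ≤ lam) (hlam : lam ≤ a.r * (1 - a.β)) {x : InfoState}
    (hx : ¬ a.HasPriority lam x) (hindex : a.whittleIndex x < lam) :
    a.optRate lam + a.waitValue lam x ≤ a.waitValue lam x.aged := by
  rcases (optRate_nonneg (a := a) (lam := lam)).eq_or_lt with hH | hH
  · rw [← hH, zero_add]
    exact waitValue_le_aged hlam hx
  obtain ⟨_ | _, t⟩ := x
  · have hwait := not_lt.1 fun hplay =>
      (playOptimal_bad h0 hH (t := t) hplay.le).le_whittleIndex.not_gt hindex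
    exact (add_comm _ _).trans_le (waitValue_bad_add_optRate hwait).ge
  · exact absurd hindex (playOptimal_good h0 hH t).le_whittleIndex.not_gt

theorem isPotential_waitValue (h0 : 0 ≤ lam) (hlam : lam ≤ a.r * (1 - a.β)) :
    a.IsPotential lam (a.waitValue lam) where
  bounded := ⟨_, abs_waitValue_le h0 hlam⟩
  play := optRate_add_waitValue_le h0 hlam
  play_of_le_index _ := lam_add_waitValue_le h0 hlam
  rest _ := waitValue_le_aged hlam
  rest_of_index_lt _ := optRate_add_waitValue_le_aged h0 hlam

theorem isPotential_zero (hlam : a.r * (1 - a.β) < lam) : a.IsPotential lam fun _ => 0 where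
  bounded := ⟨0, fun _ => abs_zero.le⟩
  play x := by
    rw [optRate_eq_zero hlam.le]
    simpa [infoPlayValue] using mul_nonneg (a.belief_nonneg x) a.r_nonneg
  play_of_le_index x hx :=
    (hlam.not_ge (hx.elim And.right fun hindex => hindex.trans (a.whittleIndex_le x))).elim
  rest _ _ := le_rfl
  rest_of_index_lt _ _ _ := by rw [optRate_eq_zero hlam.le, add_zero]

variable (a) in
theorem exists_isPotential (h0 : 0 ≤ lam) : ∃ φ, a.IsPotential lam φ :=
  (le_or_gt lam (a.r * (1 - a.β))).elim (fun h => ⟨_, isPotential_waitValue h0 h⟩)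
    fun h => ⟨_, isPotential_zero h⟩

end Arm

theorem infoAfter_eq_good_one_unique {ι : Type} [DecidableEq ι] {x : ι → InfoState}
    {h : History ι} (hne : h ≠ []) {i j : ι} (hi : infoAfter x h i = (true, 1))
    (hj : infoAfter x h j = (true, 1)) : i = j := by
  have aged_ne (y : InfoState) : y.aged ≠ (true, 1) := fun hy =>
    (PNat.lt_add_left 1 y.2).ne' (congrArg Prod.snd hy)
  obtain _ | ⟨_ | ⟨k, s⟩, h⟩ := h
  · exact absurd rfl hne
  · exact absurd hi (aged_ne _)
  · have eq_played {i : ι} (hi : infoAfter x (some (k, s) :: h) i = (true, 1)) : i = k := by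
      by_contra hik
      exact aged_ne _ ((if_neg hik).symm.trans hi)
    exact (eq_played hi).trans (eq_played hj).symm

section ThresholdWhittle

variable {ι : Type} [Fintype ι] [DecidableEq ι] {arms : ι → Arm} {lam : ℝ} {x : ι → InfoState}
  {φ : ι → InfoState → ℝ}

theorem le_lookahead_of_thresholdWhittleChoice (hlam : lam = ∑ i, (arms i).optRate lam)
    (hφ : ∀ i, (arms i).IsPotential lam (φ i)) {h : History ι} (hne : h ≠ []) {j : ι}
    (hj : ThresholdWhittleChoice arms lam (infoAfter x h) j) :
    lam + ∑ i, φ i (infoAfter x h i) ≤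
      lookahead arms 0 x (fun h => ∑ i, φ i (infoAfter x h i)) h (some j) := by
  rw [lookahead_sum_some, sub_zero]
  by_cases hindex : TopPriority arms lam (infoAfter x h) j ∨
      lam ≤ (arms j).whittleIndex (infoAfter x h j)
  · have others_rest : ∀ i ∈ Finset.univ.erase j, ¬ (arms i).HasPriority lam (infoAfter x h i) :=
      fun i hi hpriority => hj.elim
        (fun htop => Finset.ne_of_mem_erase hi
          (infoAfter_eq_good_one_unique hne hpriority.1 htop.1))
        fun hmax => hmax.1 i hpriority
    rw [← Finset.add_sum_erase _ _ (Finset.mem_univ j), ← add_assoc]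
    exact add_le_add ((hφ j).play_of_le_index _ hindex)
      (Finset.sum_le_sum fun i hi => (hφ i).rest _ (others_rest i hi))
  · obtain ⟨not_top, index_lt⟩ := not_or.1 hindex
    obtain ⟨no_top, index_le⟩ := hj.resolve_left not_top
    nth_rw 1 [hlam]
    rw [← Finset.sum_add_distrib, ← Finset.add_sum_erase _ _ (Finset.mem_univ j)]
    exact add_le_add ((hφ j).play _) (Finset.sum_le_sum fun i _ =>
      (hφ i).rest_of_index_lt _ (no_top i) ((index_le i).trans_lt (not_le.1 index_lt)))

theorem exists_le_total_of_isThresholdWhittle (hlam : lam = ∑ i, (arms i).optRate lam)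
    {π : Policy ι} (hπ : IsThresholdWhittle arms lam x π) :
    ∃ C, ∀ T : ℕ, lam * T + C ≤ total arms 0 x π T := by
  have h0 : 0 ≤ lam := hlam ▸ Finset.sum_nonneg fun i _ => Arm.optRate_nonneg
  choose φ hφ using fun i => (arms i).exists_isPotential h0
  choose M hM using fun i => (hφ i).bounded
  have abs_sum_le (h : History ι) : |∑ i, φ i (infoAfter x h i)| ≤ ∑ i, M i :=
    (Finset.abs_sum_le_sum_abs _ _).trans (Finset.sum_le_sum fun i _ => hM i _)
  -- Initially several arms may be in the state `(g, 1)`, and then the sum of the potentials need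
  -- not increase by `lam`; the value at the empty history is so small that the first step gains it.
  let Φ (h : History ι) : ℝ :=
    if h = [] then -(lam + ∑ i, M i) else ∑ i, φ i (infoAfter x h i)
  have lookahead_eq (h : History ι) (c : Option ι) : lookahead arms 0 x Φ h c =
      lookahead arms 0 x (fun h => ∑ i, φ i (infoAfter x h i)) h c := by
    cases c <;> simp [lookahead, Φ]
  have Φ_le (h : History ι) : Φ h ≤ ∑ i, M i := by
    simp only [Φ]
    split_ifs
    · linarith [(abs_nonneg _).trans (abs_sum_le [])]
    · exact (le_abs_self _).trans (abs_sum_le h)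
  have drift : ∀ h, ∀ c ∈ (π h).support, lam + Φ h ≤ lookahead arms 0 x Φ h c := by
    intro h c hc
    rw [lookahead_eq]
    rcases eq_or_ne h [] with rfl | hne
    · have := sub_abs_le_lookahead arms 0 x (fun h => (abs_le.1 (abs_sum_le h)).1) [] c
      simp only [Φ, if_true]
      rw [abs_zero, sub_zero] at this
      linarith
    · obtain ⟨j, rfl, hj⟩ := hπ h c hc
      simp only [Φ, hne, if_false]
      exact le_lookahead_of_thresholdWhittleChoice hlam hφ hne hj
  refine ⟨Φ [] - ∑ i, M i, fun T => ?_⟩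
  have := le_totalAfter_of_le_lookahead Φ_le drift T []
  rw [total_eq_totalAfter]
  linarith

end ThresholdWhittle

section Approximation

variable {ι : Type} [Fintype ι] {arms : ι → Arm} {lam : ℝ}

theorem existsUnique_eq_sum_H (arms : ι → Arm) : ∃! lam : ℝ, lam = ∑ i, (arms i).H lam := by
  have H_eqOn (i : ι) : EqOn (arms i).H (arms i).optRate (Ici 0) := fun _ h0 =>
    Arm.H_eq_optRate h0
  refine existsUnique_eq_of_antitoneOn (continuousOn_finsetSum _ fun i _ => ?_)
    (fun l hl m hm hlm => Finset.sum_le_sum fun i _ => ?_)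
    fun l => Finset.sum_nonneg fun i _ => (arms i).H_nonneg l
  · exact (arms i).continuous_optRate.continuousOn.congr (H_eqOn i)
  · rw [H_eqOn i hl, H_eqOn i hm]
    exact (arms i).optRate_antitone hlm

theorem nonneg_of_eq_sum_H (hlam : lam = ∑ i, (arms i).H lam) : 0 ≤ lam :=
  hlam ▸ Finset.sum_nonneg fun i _ => (arms i).H_nonneg lam

theorem eq_sum_optRate (hlam : lam = ∑ i, (arms i).H lam) :
    lam = ∑ i, (arms i).optRate lam :=
  hlam.trans (Finset.sum_congr rfl fun _ _ => Arm.H_eq_optRate (nonneg_of_eq_sum_H hlam))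

variable [DecidableEq ι] {x : ι → InfoState}

theorem limsup_averageReward_le (hlam : lam = ∑ i, (arms i).H lam) (σ : Policy ι) :
    limsup (averageReward arms x σ) atTop ≤ 2 * lam := by
  obtain ⟨C, hC⟩ := exists_total_le arms (nonneg_of_eq_sum_H hlam) x σ
  rw [← eq_sum_optRate hlam, sub_zero, ← two_mul] at hC
  exact limsup_div_nat_le (D := 0) (fun T => by
    rw [add_zero]
    exact neg_abs_mul_le_total arms 0 x σ T) hC

theorem le_liminf_averageReward (hlam : lam = ∑ i, (arms i).H lam) {π : Policy ι}
    (hπ : IsThresholdWhittle arms lam x π) : lam ≤ liminf (averageReward arms x π) atTop := by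
  obtain ⟨D, hD⟩ := exists_le_total_of_isThresholdWhittle (eq_sum_optRate hlam) hπ
  obtain ⟨C, hC⟩ := exists_total_le arms (nonneg_of_eq_sum_H hlam) x π
  exact le_liminf_div_nat hD hC

end Approximation

end FeedbackMAB

theorem mainTheorem3_general {ι : Type} [Fintype ι] [DecidableEq ι] (arms : ι → FeedbackMAB.Arm)
    (x : ι → FeedbackMAB.InfoState) :
    (∃! lam : ℝ, lam = ∑ i, (arms i).H lam) ∧
    ∀ lam : ℝ, lam = ∑ i, (arms i).H lam →
      ∀ π : FeedbackMAB.Policy ι, FeedbackMAB.IsThresholdWhittle arms lam x π →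
        ∀ σ : FeedbackMAB.Policy ι,
          Filter.limsup (FeedbackMAB.averageReward arms x σ) Filter.atTop ≤
            2 * Filter.liminf (FeedbackMAB.averageReward arms x π) Filter.atTop :=
  ⟨FeedbackMAB.existsUnique_eq_sum_H arms, fun _ hlam _ hπ σ =>
    (FeedbackMAB.limsup_averageReward_le hlam σ).trans
      (mul_le_mul_of_nonneg_left (FeedbackMAB.le_liminf_averageReward hlam hπ) zero_le_two)⟩

theorem mainTheorem3 {n : ℕ} (arms : Fin n → FeedbackMAB.Arm)
    (x : Fin n → FeedbackMAB.InfoState) :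
    (∃! lam : ℝ, lam = ∑ i, (arms i).H lam) ∧
    ∀ lam : ℝ, lam = ∑ i, (arms i).H lam →
      ∀ π : FeedbackMAB.Policy (Fin n), FeedbackMAB.IsThresholdWhittle arms lam x π →
        ∀ σ : FeedbackMAB.Policy (Fin n),
          Filter.limsup (FeedbackMAB.averageReward arms x σ) Filter.atTop ≤
            2 * Filter.liminf (FeedbackMAB.averageReward arms x π) Filter.atTop :=
  mainTheorem3_general arms x
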